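/- Let $k$ be a perfect field of characteristic $p>0$, and let $A$ be a nonzero Noetherian commutative $k$-algebra which is $F$-finite (the Frobenius $F\colon A\to A$ is a finite ring map). Let $D\in\mathrm{Der}_k(A)$ be a multiplicative derivation: the $p$-fold composition satisfies $D^{[p]}=uD$ for some unit $u\in A^\times$. Let $A^D=\{a\in A\mid D(a)=0\}$ be the subring of constants. Then $A^D$ is Noetherian and $F$-finite, and: 1. For every integer $r\ge 0$, if $A$ satisfies Serre's condition $S_r$ (that is, $\operatorname{depth} A_{\mathfrak p}\ge\min\{r,\dim A_{\mathfrak p}\}$ for every prime $\mathfrak p$), then so does $A^D$. 2. If $A$ is $F$-pure (resp. $F$-rational, $F$-injective, $F$-regular), then so is $A^D$. Here, for a Noetherian $F$-finite ring $R$ of characteristic $p$, $F^e_*R$ is $R$ regarded as an $R$-module through the $e$-th iterate $F^e$ of Frobenius, and $R^\circ$ is the set of elements of $R$ lying in no minimal prime. The ring $R$ is: - *$F$-pure* if $F\colon R\to F_*R$ is pure, i.e. stays injective after tensoring with any $R$-module; - *$F$-injective* if for every prime $\mathfrak p$ and every $i\ge 0$ the map $H^i_{\mathfrak pR_{\mathfrak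 p}}(R_{\mathfrak p})\to H^i_{\mathfrak pR_{\mathfrak p}}(F_*R_{\mathfrak p})$ induced by Frobenius is injective; - *$F$-rational* if for every prime $\mathfrak p$ the local ring $S=R_{\mathfrak p}$, with maximal ideal $\mathfrak m$ and dimension $d$, is Cohen--Macaulay and for every $c\in S^\circ$ there is $e>0$ such that the composition $H^d_{\mathfrak m}(S)\xrightarrow{F^e}H^d_{\mathfrak m}(F^e_*S)\xrightarrow{F^e_*c}H^d_{\mathfrak m}(F^e_*S)$ is injective; - *$F$-regular* if it is strongly $F$-regular: for every $c\in R^\circ$ there is $e>0$ such that the $R$-linear map $R\to F^e_*R$, $1\mapsto F^e_*c$, splits. The statement also holds for $F$-regularity in the sense of tight closure: in every localization of $R$ every ideal $I$ is tightly closed, i.e. contains each $x$ for which there is $c$ in no minimal prime with $cx^{p^e}\in I^{[p^e]}$ for all $e\gg0$. -/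

import Mathlib

open CategoryTheory

universe u

noncomputable section

/-! ### Derivations -/

section Derivations

variable {k : Type*} {A : Type u} [CommRing k] [CommRing A] [Algebra k A]

/-- The subring of constants `A^D = {a ∈ A | D a = 0}` of a `k`-derivation `D` of `A`,
as a `k`-subalgebra of `A`. -/
def Derivation.constants (D : Derivation k A A) : Subalgebra k A where
  carrier := {a | D a = 0}
  mul_mem' := by
    intro a b (ha : D a = 0) (hb : D b = 0)
    simp [ha, hb]
  add_mem' := by
    intro a b (ha : D a = 0) (hb : D b = 0)
    simp [ha, hb]
  algebraMap_mem' := fun r => D.map_algebraMap r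

/-- `D` is multiplicative (with respect to `p`): its `p`-fold composition with itself is `u D`
for some unit `u` of `A`. -/
def Derivation.IsMultiplicative (D : Derivation k A A) (p : ℕ) : Prop :=
  ∃ u : Aˣ, ∀ a : A, (⇑D)^[p] a = (u : A) * D a

instance Derivation.constants_charP (D : Derivation k A A) (p : ℕ) [CharP A p] :
    CharP D.constants p :=
  ⟨fun n => by
    rw [← CharP.cast_eq_zero_iff A p n, ← Subtype.coe_inj]
    simp⟩

end Derivations

/-- A localization at a prime ideal of a ring of prime characteristic `p` has characteristic `p`. -/
instance Localization.AtPrime.charP_of_prime (R : Type u) [CommRing R] (p : ℕ) [Fact p.Prime]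
    [CharP R p] (P : Ideal R) [P.IsPrime] : CharP (Localization.AtPrime P) p := by
  have h : ((p : ℕ) : Localization.AtPrime P) = 0 := by
    rw [← map_natCast (algebraMap R (Localization.AtPrime P)), CharP.cast_eq_zero, map_zero]
  obtain ⟨q, hq⟩ := CharP.exists (Localization.AtPrime P)
  have hqp : q ∣ p := (CharP.cast_eq_zero_iff (Localization.AtPrime P) q p).mp h
  rcases (Nat.dvd_prime Fact.out).mp hqp with h1 | h1
  · exact absurd h1 (CharP.char_ne_one (Localization.AtPrime P) q)
  · exact h1 ▸ hq

/-! ### Depth, Serre's conditions, Cohen-Macaulay local rings -/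

/-- The depth of a local ring: the supremum of the lengths of the regular sequences contained in
its maximal ideal. -/
def localDepth (R : Type u) [CommRing R] [IsLocalRing R] : ℕ∞ :=
  ⨆ (rs : List R) (_ : (∀ x ∈ rs, x ∈ IsLocalRing.maximalIdeal R) ∧
    RingTheory.Sequence.IsRegular R rs), (rs.length : ℕ∞)

/-- Serre's condition `S_r`: `depth R_P ≥ min (r, dim R_P)` for every prime ideal `P`. -/
def SatisfiesSerre (R : Type u) [CommRing R] (r : ℕ) : Prop :=
  ∀ (P : Ideal R) [P.IsPrime],
    min (r : WithBot ℕ∞) (ringKrullDim (Localization.AtPrime P)) ≤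
      (localDepth (Localization.AtPrime P) : WithBot ℕ∞)

/-- A local ring is Cohen-Macaulay if its depth equals its dimension. -/
def IsCohenMacaulayLocal (R : Type u) [CommRing R] [IsLocalRing R] : Prop :=
  (localDepth R : WithBot ℕ∞) = ringKrullDim R

/-! ### The iterated Frobenius -/

/-- The `R`-module `F^e_* R`: the additive group of `R`, on which `r ∈ R` acts as multiplication
by `r ^ (p ^ e)`. -/
def FrobeniusPushforward (R : Type u) (_p _e : ℕ) : Type u := R

section Frobenius

variable (R : Type u) [CommRing R] (p e : ℕ)

instance : AddCommGroup (FrobeniusPushforward R p e) := inferInstanceAs (AddCommGroup R)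

variable {R} in
/-- The element `F^e_* c` of `F^e_* R`. -/
def FrobeniusPushforward.mk (c : R) : FrobeniusPushforward R p e := c

variable [Fact p.Prime] [CharP R p]

instance : Module R (FrobeniusPushforward R p e) :=
  Module.compHom R (iterateFrobenius R p e)

/-- The `e`-th iterate of Frobenius as an `R`-linear map `R → F^e_* R`. -/
def frobeniusLinear : R →ₗ[R] FrobeniusPushforward R p e where
  toFun r := FrobeniusPushforward.mk p e (iterateFrobenius R p e r)
  map_add' := map_add (iterateFrobenius R p e)
  map_smul' := map_mul (iterateFrobenius R p e)

variable {R} in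
/-- Multiplication by `F^e_* c` as an `R`-linear endomorphism of `F^e_* R`. -/
def frobeniusMul (c : R) : FrobeniusPushforward R p e →ₗ[R] FrobeniusPushforward R p e where
  toFun x := FrobeniusPushforward.mk p e (c * (show R from x))
  map_add' := mul_add c
  map_smul' a := mul_left_comm c (iterateFrobenius R p e a)

/-- `R` is `F`-finite: the Frobenius endomorphism is a finite ring homomorphism. -/
def IsFFinite : Prop := (frobenius R p).Finite

/-- `R` is `F`-pure: the Frobenius `R → F_* R` is pure, i.e. it stays injective after tensoring
with any `R`-module. -/
def IsFPure : Prop :=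
  ∀ (M : Type u) [AddCommGroup M] [Module R M],
    Function.Injective (LinearMap.lTensor M (frobeniusLinear R p 1))

/-- `R` is strongly `F`-regular: for every `c` in no minimal prime of `R` there is `e > 0` such
that the `R`-linear map `R → F^e_* R`, `1 ↦ F^e_* c`, splits. -/
def IsStronglyFRegular : Prop :=
  ∀ c : R, (∀ P ∈ minimalPrimes R, c ∉ P) →
    ∃ e : ℕ, 0 < e ∧ ∃ φ : FrobeniusPushforward R p e →ₗ[R] R,
      φ ∘ₗ frobeniusMul p e c ∘ₗ frobeniusLinear R p e = LinearMap.id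

variable [IsLocalRing R]

/-- A local ring `(R, m)` is `F`-injective if Frobenius is injective on `H^i_m(R)` for all `i`. -/
def IsFInjectiveLocal : Prop :=
  ∀ i : ℕ, Function.Injective
    ((localCohomology (IsLocalRing.maximalIdeal R) i).map
      (ModuleCat.ofHom (frobeniusLinear R p 1)))

/-- A local ring `(R, m)` of dimension `d` is `F`-rational if it is Cohen-Macaulay and for every
`c` in no minimal prime of `R` there is `e > 0` such that the composition
`H^d_m(R) → H^d_m(F^e_* R) → H^d_m(F^e_* R)` of the `e`-th iterate of Frobenius and of the
multiplication by `F^e_* c` is injective. -/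
def IsFRationalLocal : Prop :=
  IsCohenMacaulayLocal R ∧
  ∀ d : ℕ, ringKrullDim R = (d : WithBot ℕ∞) →
    ∀ c : R, (∀ P ∈ minimalPrimes R, c ∉ P) →
      ∃ e : ℕ, 0 < e ∧ Function.Injective
        ((localCohomology (IsLocalRing.maximalIdeal R) d).map
            (ModuleCat.ofHom (frobeniusLinear R p e)) ≫
          (localCohomology (IsLocalRing.maximalIdeal R) d).map
            (ModuleCat.ofHom (frobeniusMul p e c)))

end Frobenius

section Global

variable (R : Type u) [CommRing R] (p : ℕ)

/-- `R` is `F`-injective: all its localizations at prime ideals are. -/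
def IsFInjective [Fact p.Prime] [CharP R p] : Prop :=
  ∀ (P : Ideal R) [P.IsPrime], IsFInjectiveLocal (Localization.AtPrime P) p

/-- `R` is `F`-rational: all its localizations at prime ideals are. -/
def IsFRational [Fact p.Prime] [CharP R p] : Prop :=
  ∀ (P : Ideal R) [P.IsPrime], IsFRationalLocal (Localization.AtPrime P) p

variable {R} in
/-- `x` belongs to the tight closure of `I`: there is `c` in no minimal prime of `R` such that
`c x^q ∈ I^[q]` for all large `q = p ^ e`, where `I^[q]` is generated by the `q`-th powers of the
elements of `I`. -/
def InTightClosure (I : Ideal R) (x : R) : Prop :=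
  ∃ c : R, (∀ P ∈ minimalPrimes R, c ∉ P) ∧ ∃ e₀ : ℕ, ∀ e ≥ e₀,
    c * x ^ p ^ e ∈ Ideal.span ((fun y : R => y ^ p ^ e) '' (I : Set R))

/-- `R` is `F`-regular in the sense of tight closure: in every localization of `R`, every ideal is
tightly closed. -/
def IsTightlyFRegular : Prop :=
  ∀ (S : Submonoid R) (I : Ideal (Localization S)) (x : Localization S),
    InTightClosure p I x → x ∈ I

end Global

end

/-! The proof uses only two properties of `B = A^D ⊆ A`, packaged as `IsSplitRadicial`: there is a
`B`-linear `π : A → B` with `π 1 = 1`, and every `a ^ p` lies in `B`. The second holds because `D (a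
^ p) = p a ^ (p - 1) D a = 0`. For the first, put `π a = a - u⁻¹ D^(p-1) a`. Since `D` commutes with
`D^p`, one gets `D u * D a = 0`, so `u` behaves like a constant and `D (π a) = D a - u⁻¹ D^p a = 0`.
These properties pass to localizations.

Radiciality makes `Spec A → Spec B` a homeomorphism, so dimensions and minimal primes correspond.
Frobenius of `A` factors through `B`, so `A` is finite over `B`. The retraction gives `IA ∩ B = I`,
hence Noetherianity and descent of tight closure, and it carries Frobenius splittings and purity
from `A` to `B`. For depth, the `p`-th powers of an `A`-regular sequence lie in `B`, and they are
regular on `B`, a direct summand of `A` (`localDepth_le`).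

For `F`-injectivity and `F`-rationality in the local case, `H^i(B) → H^i(A)` is split injective over
`B`, so it suffices that injectivity on `H^i_{m_A}` of an `A`-linear map survives as injectivity on
`H^i_{m_B}` (`localCohomology.injective_map_restrictScalars`). This is shown by dimension shifting
along injective `A`-modules. They need not be injective over `B`, but they have no higher local
cohomology there: each is a summand of some `Hom_B(A, Q)` with `Q` injective, which Artin–Rees
handles. -/

noncomputable section

section SplitRadicial

open TensorProduct

/-- The ring map `B → A` splits as a map of `B`-modules, and every `p`-th power of an element of `A`
comes from `B`. -/
structure IsSplitRadicial (B A : Type*) [CommRing B] [CommRing A] [Algebra B A] (p : ℕ) : Prop where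
  exists_retraction : ∃ π : A →ₗ[B] B, π 1 = 1
  exists_algebraMap_eq_pow : ∀ a : A, ∃ b : B, algebraMap B A b = a ^ p

/-! ### The retraction onto the constants -/

section Derivation

variable {k : Type*} {A : Type u} [CommRing k] [CommRing A] [Algebra k A] {p : ℕ}
  (D : Derivation k A A)

namespace Derivation

/-- Compute `D^(p+1) a` in two ways: `D (u * D a)` has the extra Leibniz term `D u * D a` compared
with `D^p (D a) = u * D (D a)`. -/
lemma apply_unit_mul_apply_eq_zero {u : A} (h : ∀ a, (⇑D)^[p] a = u * D a) (a : A) :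
    D u * D a = 0 := by
  have h1 : D ((⇑D)^[p] a) = (⇑D)^[p] (D a) := by
    rw [← Function.iterate_succ_apply' (⇑D), Function.iterate_succ_apply]
  rw [h, h, D.leibniz, smul_eq_mul, smul_eq_mul] at h1
  linear_combination h1

/-- `D ^ n` as a linear map over the constants of `D`. -/
def iterateConstants (n : ℕ) : A →ₗ[D.constants] A where
  toFun := (⇑D)^[n]
  map_add' := by
    induction n with
    | zero => simp
    | succ n ih => intro x y; simp [Function.iterate_succ_apply', ih]
  map_smul' := by
    rintro ⟨c, hc : D c = 0⟩ x
    induction n with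
    | zero => simp
    | succ n ih =>
      simp only [RingHom.id_apply, Subalgebra.smul_def, smul_eq_mul] at ih ⊢
      rw [Function.iterate_succ_apply', Function.iterate_succ_apply', ih, D.leibniz, hc]
      simp

/-- The retraction is `1 - u⁻¹ D^(p-1)`. For `u = 1` this is the projection onto the eigenvalue `0`,
since nonzero elements of `F_p` have `(p-1)`-st power `1`. -/
theorem IsMultiplicative.isSplitRadicial [Fact p.Prime] [CharP A p] {D : Derivation k A A}
    (hD : D.IsMultiplicative p) : IsSplitRadicial D.constants A p where
  exists_retraction := by
    obtain ⟨u, hu⟩ := hD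
    -- With `p = q + 2`, the exponent `p - 1` is `q + 1`; it is positive, so `D^(p-1)` kills `1`.
    obtain ⟨q, rfl⟩ : ∃ q, p = q + 2 := ⟨p - 2, by have := (Fact.out : p.Prime).two_le; omega⟩
    have hD1 : D (1 : A) = 0 := D.map_one_eq_zero
    have key : ∀ a, D (a - (↑u⁻¹ : A) * (⇑D)^[q + 1] a) = 0 := by
      intro a
      have h0 := D.apply_unit_mul_apply_eq_zero hu ((⇑D)^[q] a)
      rw [← Function.iterate_succ_apply' (⇑D)] at h0
      have h1 : D ((⇑D)^[q + 1] a) = u * D a := by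
        rw [← hu, ← Function.iterate_succ_apply' (⇑D)]
      have h2 : D (↑u⁻¹ : A) = - ((↑u⁻¹ : A) * (↑u⁻¹ : A) * D (u : A)) := by
        have h3 : D ((↑u⁻¹ : A) * u) = 0 := by rw [u.inv_mul, hD1]
        rw [D.leibniz, smul_eq_mul, smul_eq_mul] at h3
        linear_combination (↑u⁻¹ : A) * h3 - D (↑u⁻¹ : A) * u.inv_mul
      rw [map_sub, D.leibniz, smul_eq_mul, smul_eq_mul, h1, h2]
      linear_combination (↑u⁻¹ : A) * (↑u⁻¹ : A) * h0 - D a * u.inv_mul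
    refine ⟨⟨⟨fun a => ⟨a - (↑u⁻¹ : A) * (⇑D)^[q + 1] a, key a⟩, fun a b => ?_⟩, fun c a => ?_⟩, ?_⟩
    · refine Subtype.ext ?_
      have := (D.iterateConstants (q + 1)).map_add a b
      change (⇑D)^[q + 1] (a + b) = (⇑D)^[q + 1] a + (⇑D)^[q + 1] b at this
      simp only [Subalgebra.coe_add, this]
      ring
    · refine Subtype.ext ?_
      have := (D.iterateConstants (q + 1)).map_smul c a
      change (⇑D)^[q + 1] (c • a) = c • (⇑D)^[q + 1] a at this
      change c • a - (↑u⁻¹ : A) * (⇑D)^[q + 1] (c • a) = c * (a - (↑u⁻¹ : A) * (⇑D)^[q + 1] a)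
      rw [this, Subalgebra.smul_def, Subalgebra.smul_def, smul_eq_mul, smul_eq_mul]
      ring
    · refine Subtype.ext ?_
      have h0 : (⇑D)^[q + 1] 1 = 0 := by
        rw [Function.iterate_succ_apply, hD1]
        exact (D.iterateConstants q).map_zero
      change 1 - (↑u⁻¹ : A) * (⇑D)^[q + 1] 1 = 1
      rw [h0, mul_zero, sub_zero]
  exists_algebraMap_eq_pow a := ⟨⟨a ^ p, by
    change D (a ^ p) = 0
    rw [D.leibniz_pow, ← Nat.cast_smul_eq_nsmul A, CharP.cast_eq_zero, zero_smul]⟩, rfl⟩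

end Derivation

end Derivation

/-! ### Ideals, spectra and finiteness for split radicial extensions -/

namespace IsSplitRadicial

section

variable {B A : Type*} [CommRing B] [CommRing A] [Algebra B A] {p : ℕ}

section
variable (h : IsSplitRadicial B A p)
include h

lemma algebraMap_injective : Function.Injective (algebraMap B A) := by
  obtain ⟨π, hπ⟩ := h.exists_retraction
  intro x y hxy
  have := congrArg π hxy
  simpa [Algebra.algebraMap_eq_smul_one, hπ] using this

lemma comap_map_eq (I : Ideal B) : (I.map (algebraMap B A)).comap (algebraMap B A) = I := by
  obtain ⟨π, hπ⟩ := h.exists_retraction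
  refine le_antisymm (fun b hb => ?_) Ideal.le_comap_map
  -- `π` is only `B`-linear, so the multiplier `c` must be carried through the span induction to
  -- absorb scalars from `A`.
  have key : ∀ a ∈ I.map (algebraMap B A), ∀ c : A, π (c * a) ∈ I := by
    intro a ha
    refine Submodule.span_induction ?_ ?_ ?_ ?_ ha
    · rintro _ ⟨b, hb, rfl⟩ c
      rw [mul_comm, ← Algebra.smul_def, map_smul]
      exact I.mul_mem_right _ hb
    · simp
    · intro x y _ _ hx hy c
      rw [mul_add, map_add]
      exact I.add_mem (hx c) (hy c)
    · intro a x _ hx c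
      rw [smul_eq_mul, ← mul_assoc]
      exact hx _
  simpa [Algebra.algebraMap_eq_smul_one, hπ] using key _ hb 1

/-- Extension of ideals to `A` is strictly monotone because contraction undoes it, so ascending
chains of `B` stabilize. -/
lemma isNoetherianRing [IsNoetherianRing A] : IsNoetherianRing B := by
  have hm : StrictMono (Ideal.map (algebraMap B A)) := fun I J hIJ =>
    lt_of_le_of_ne (Ideal.map_mono hIJ.le)
      fun he => hIJ.ne (by rw [← h.comap_map_eq I, he, h.comap_map_eq])
  rw [isNoetherianRing_iff, isNoetherian_iff']
  exact hm.wellFoundedGT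

lemma isHomeomorph_comap [Fact p.Prime] :
    IsHomeomorph (PrimeSpectrum.comap (algebraMap B A)) :=
  PrimeSpectrum.isHomeomorph_comap _
    (fun a => ⟨p, (Fact.out : p.Prime).pos, h.exists_algebraMap_eq_pow a⟩)
    (by rw [(RingHom.injective_iff_ker_eq_bot _).1 h.algebraMap_injective]; exact bot_le)

lemma exists_comap_eq [Fact p.Prime] (q : Ideal B) [q.IsPrime] :
    ∃ P : Ideal A, P.IsPrime ∧ P.comap (algebraMap B A) = q := by
  obtain ⟨P, hP⟩ := h.isHomeomorph_comap.surjective ⟨q, inferInstance⟩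
  exact ⟨P.asIdeal, P.isPrime, congrArg PrimeSpectrum.asIdeal hP⟩

lemma comap_le_comap_iff [Fact p.Prime] {P Q : Ideal A} [Q.IsPrime] :
    P.comap (algebraMap B A) ≤ Q.comap (algebraMap B A) ↔ P ≤ Q := by
  refine ⟨fun hPQ a ha => ?_, fun hPQ => Ideal.comap_mono hPQ⟩
  obtain ⟨b, hb⟩ := h.exists_algebraMap_eq_pow a
  have hp : 0 < p := (Fact.out : p.Prime).pos
  refine (inferInstance : Q.IsPrime).mem_of_pow_mem p ?_
  rw [← hb]
  exact hPQ (by rw [Ideal.mem_comap, hb]; exact P.pow_mem_of_mem ha p hp)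

lemma ringKrullDim_eq [Fact p.Prime] : ringKrullDim A = ringKrullDim B :=
  Order.krullDim_eq_of_orderIso
    { Equiv.ofBijective _ h.isHomeomorph_comap.bijective with
      map_rel_iff' := h.comap_le_comap_iff }

lemma comap_mem_minimalPrimes [Fact p.Prime] {P : Ideal A} (hP : P ∈ minimalPrimes A) :
    P.comap (algebraMap B A) ∈ minimalPrimes B := by
  have : P.IsPrime := hP.1.1
  refine ⟨⟨inferInstance, bot_le⟩, fun q ⟨hq, _⟩ hqP => ?_⟩
  obtain ⟨Q, hQ, rfl⟩ := h.exists_comap_eq q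
  exact Ideal.comap_mono (hP.2 ⟨hQ, bot_le⟩ (h.comap_le_comap_iff.1 hqP))

lemma algebraMap_notMem_of_mem_minimalPrimes [Fact p.Prime] {c : B}
    (hc : ∀ q ∈ minimalPrimes B, c ∉ q) : ∀ P ∈ minimalPrimes A, algebraMap B A c ∉ P :=
  fun _ hP hcP => hc _ (h.comap_mem_minimalPrimes hP) hcP

/-- Frobenius of `A` is the composite of `a ↦ a ^ p`, `A → B`, with `B → A`; the last factor of a
finite composite is finite. -/
lemma algebraMap_finite [Fact p.Prime] [CharP A p] (hA : IsFFinite A p) :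
    (algebraMap B A).Finite := by
  choose φ hφ using h.exists_algebraMap_eq_pow
  let φ' : A →+* B :=
    { toFun := φ
      map_one' := h.algebraMap_injective (by simp [hφ])
      map_mul' := fun x y => h.algebraMap_injective (by simp [hφ, mul_pow])
      map_zero' := h.algebraMap_injective (by simp [hφ, (Fact.out : p.Prime).ne_zero])
      map_add' := fun x y => h.algebraMap_injective (by simp [hφ, add_pow_char]) }
  have hφ' : (algebraMap B A).comp φ' = frobenius A p := RingHom.ext hφ
  exact RingHom.Finite.of_comp_finite (f := φ') (by rw [hφ']; exact hA)

end

lemma _root_.RingHom.Finite.of_comp_of_retraction {R S T : Type*} [CommRing R] [CommRing S]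
    [CommRing T] {f : R →+* S} {g : S →+* T} (hfin : (g.comp f).Finite) (π : T →+ S)
    (hπ : ∀ s t, π (g s * t) = s * π t) (hsurj : Function.Surjective π) : f.Finite := by
  let := f.toAlgebra
  let := (g.comp f).toAlgebra
  have : Module.Finite R T := hfin
  exact Module.Finite.of_surjective
    ({ π with map_smul' := fun r t => hπ (f r) t } : T →ₗ[R] S) hsurj

lemma isFFinite [Fact p.Prime] [CharP B p] [CharP A p] (h : IsSplitRadicial B A p)
    (hA : IsFFinite A p) : IsFFinite B p := by
  obtain ⟨π, hπ⟩ := h.exists_retraction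
  have hfin : ((algebraMap B A).comp (frobenius B p)).Finite := by
    have : (algebraMap B A).comp (frobenius B p) = (frobenius A p).comp (algebraMap B A) :=
      RingHom.ext fun b => map_pow (algebraMap B A) b p
    rw [this]
    exact RingHom.Finite.comp hA (h.algebraMap_finite hA)
  -- `F_* B` is the image of `A` under `π`, and `A` is finite over `B` via `B → B → A` with
  -- Frobenius first.
  refine hfin.of_comp_of_retraction π.toAddMonoidHom (fun b a => ?_) fun b => ⟨algebraMap B A b, ?_⟩
  · change π _ = _ * π _
    rw [← Algebra.smul_def, map_smul, smul_eq_mul]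
  · change π _ = _
    rw [Algebra.algebraMap_eq_smul_one, map_smul, hπ, smul_eq_mul, mul_one]

end

/-! ### Descent of `F`-purity and strong `F`-regularity -/

section Pushforward

variable {B A : Type u} [CommRing B] [CommRing A] [Algebra B A] {p : ℕ} [Fact p.Prime]
  [CharP B p] [CharP A p] (h : IsSplitRadicial B A p)
include h

/-- If `m ⊗ 1` dies in `M ⊗ F_* B`, then `(1 ⊗ m) ⊗ 1` dies in `(A ⊗ M) ⊗ F_* A`. Purity of `A`
gives `1 ⊗ m = 0` in `A ⊗ M`, and `π` recovers `m = 0`. -/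
theorem isFPure (hA : IsFPure A p) : IsFPure B p := by
  intro M _ _
  obtain ⟨π, hπ⟩ := h.exists_retraction
  rw [injective_iff_map_eq_zero]
  intro x hx
  obtain ⟨m, rfl⟩ : ∃ m : M, m ⊗ₜ (1 : B) = x :=
    ⟨TensorProduct.rid B M x, (TensorProduct.rid B M).symm_apply_apply x⟩
  have h0 : ((1 : A) ⊗ₜ[B] m) = 0 := by
    let ψ : M ⊗[B] FrobeniusPushforward B p 1 →+
        (A ⊗[B] M) ⊗[A] FrobeniusPushforward A p 1 :=
      TensorProduct.liftAddHom
        { toFun := fun m =>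
            { toFun := fun b => ((1 : A) ⊗ₜ[B] m) ⊗ₜ[A]
                FrobeniusPushforward.mk p 1 (algebraMap B A (show B from b))
              map_zero' := by
                rw [← TensorProduct.tmul_zero]
                exact congrArg _ (map_zero (algebraMap B A))
              map_add' := fun x y => by
                rw [← TensorProduct.tmul_add]
                exact congrArg _ (map_add (algebraMap B A) _ _) }
          map_zero' := by ext; simp
          map_add' := fun x y => by ext; simp [TensorProduct.tmul_add, TensorProduct.add_tmul] }
        (fun b m x => by
          change ((1 : A) ⊗ₜ[B] (b • m)) ⊗ₜ[A] _ = ((1 : A) ⊗ₜ[B] m) ⊗ₜ[A] _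
          rw [TensorProduct.tmul_smul, ← algebraMap_smul A b ((1 : A) ⊗ₜ[B] m),
            TensorProduct.smul_tmul]
          congr 1
          change iterateFrobenius A p 1 (algebraMap B A b) * algebraMap B A (show B from x) =
            algebraMap B A (iterateFrobenius B p 1 b * (show B from x))
          rw [map_mul, iterateFrobenius_def, iterateFrobenius_def, map_pow])
    have h1 := congrArg ψ hx
    rw [map_zero, LinearMap.lTensor_tmul] at h1
    have h2 : LinearMap.lTensor (A ⊗[B] M) (frobeniusLinear A p 1)
        (((1 : A) ⊗ₜ[B] m) ⊗ₜ[A] (1 : A)) = 0 := by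
      rw [← h1, LinearMap.lTensor_tmul]
      change _ ⊗ₜ[A] FrobeniusPushforward.mk p 1 (iterateFrobenius A p 1 1) =
        ((1 : A) ⊗ₜ[B] m) ⊗ₜ[A] FrobeniusPushforward.mk p 1
          (algebraMap B A (iterateFrobenius B p 1 1))
      simp only [map_one]
    have h3 := (map_eq_zero_iff _ (hA (A ⊗[B] M))).1 h2
    have h4 := congrArg (TensorProduct.rid A (A ⊗[B] M)) h3
    simpa using h4
  have h1 := congrArg (fun t => TensorProduct.lid B M (π.rTensor M t)) h0
  have h2 : m = 0 := by simpa [hπ] using h1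
  rw [h2, TensorProduct.zero_tmul]

/-- A splitting `φ` for the image of `c` in `A` restricts to `F^e_* B`, and `π ∘ φ` then splits for
`c`. -/
theorem isStronglyFRegular (hA : IsStronglyFRegular A p) : IsStronglyFRegular B p := by
  intro c hc
  obtain ⟨π, hπ⟩ := h.exists_retraction
  obtain ⟨e, he, φ, hφ⟩ := hA _ (h.algebraMap_notMem_of_mem_minimalPrimes hc)
  refine ⟨e, he,
    { toFun := fun b => π (φ (FrobeniusPushforward.mk p e (algebraMap B A (show B from b))))
      map_add' := fun x y => by
        rw [← map_add, ← map_add]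
        exact congrArg (fun t => π (φ t)) (map_add (algebraMap B A) _ _)
      map_smul' := fun b x => by
        rw [RingHom.id_apply, ← map_smul, ← algebraMap_smul A b (φ _), ← map_smul]
        refine congrArg (fun t => π (φ t)) ?_
        change algebraMap B A (iterateFrobenius B p e b * (show B from x)) =
          iterateFrobenius A p e (algebraMap B A b) * algebraMap B A (show B from x)
        rw [map_mul, iterateFrobenius_def, iterateFrobenius_def, map_pow] }, ?_⟩
  refine LinearMap.ext_ring ?_
  have h1 := LinearMap.congr_fun hφ 1
  change π (φ (algebraMap B A (c * iterateFrobenius B p e 1))) = 1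
  change φ (algebraMap B A c * iterateFrobenius A p e 1) = 1 at h1
  rw [map_one, mul_one] at h1 ⊢
  rw [h1, hπ]

end Pushforward

/-! ### Tight closure and localization -/

section TightClosure

variable {B A : Type u} [CommRing B] [CommRing A] [Algebra B A] {p : ℕ} [Fact p.Prime]

lemma inTightClosure_map (h : IsSplitRadicial B A p) {I : Ideal B} {x : B}
    (hx : InTightClosure p I x) :
    InTightClosure p (I.map (algebraMap B A)) (algebraMap B A x) := by
  obtain ⟨c, hc, e₀, H⟩ := hx
  refine ⟨algebraMap B A c, h.algebraMap_notMem_of_mem_minimalPrimes hc, e₀, fun e he => ?_⟩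
  have h1 := Ideal.mem_map_of_mem (algebraMap B A) (H e he)
  rw [Ideal.map_span, map_mul, map_pow] at h1
  refine Ideal.span_mono ?_ h1
  rintro _ ⟨_, ⟨y, hy, rfl⟩, rfl⟩
  exact ⟨algebraMap B A y, Ideal.mem_map_of_mem _ hy, (map_pow _ _ _).symm⟩

lemma mem_of_algebraMap_mem_map {p : ℕ} (h : IsSplitRadicial B A p) {I : Ideal B} {x : B}
    (hx : algebraMap B A x ∈ I.map (algebraMap B A)) : x ∈ I := by
  rw [← h.comap_map_eq I]
  exact hx

end TightClosure

section Localization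

variable {B A : Type*} [CommRing B] [CommRing A] [Algebra B A] {p : ℕ}

lemma isLocalization (h : IsSplitRadicial B A p) (S : Submonoid B) (B' A' : Type*) [CommRing B']
    [CommRing A'] [Algebra B B'] [IsLocalization S B'] [Algebra A A'] [Algebra B A']
    [IsScalarTower B A A'] [IsLocalization (Algebra.algebraMapSubmonoid A S) A'] [Algebra B' A']
    [IsScalarTower B B' A'] : IsSplitRadicial B' A' p where
  exists_retraction := by
    obtain ⟨π, hπ⟩ := h.exists_retraction
    have : IsLocalizedModule S (IsScalarTower.toAlgHom B A A').toLinearMap :=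
      isLocalizedModule_iff_isLocalization.2 inferInstance
    let π' := IsLocalizedModule.map S (IsScalarTower.toAlgHom B A A').toLinearMap
      (Algebra.linearMap B B') π
    refine ⟨π'.extendScalarsOfIsLocalization S B', ?_⟩
    change π' 1 = 1
    have := IsLocalizedModule.map_apply S (IsScalarTower.toAlgHom B A A').toLinearMap
      (Algebra.linearMap B B') π 1
    simpa [hπ] using this
  exists_algebraMap_eq_pow a := by
    obtain ⟨⟨x, ⟨_, s, hs, rfl⟩⟩, hx⟩ :=
      IsLocalization.surj (Algebra.algebraMapSubmonoid A S) a
    obtain ⟨b, hb⟩ := h.exists_algebraMap_eq_pow x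
    -- If `a = x / s` and `b` maps to `x ^ p`, then `a ^ p` is the image of `b / s ^ p`.
    refine ⟨IsLocalization.mk' B' b (⟨s, hs⟩ ^ p : S), ?_⟩
    have hu : IsUnit (algebraMap B A' s) := by
      rw [IsScalarTower.algebraMap_apply B B' A']
      exact (IsLocalization.map_units B' (⟨s, hs⟩ : S)).map _
    have h1 := congrArg (algebraMap B' A') (IsLocalization.mk'_spec B' b (⟨s, hs⟩ ^ p : S))
    rw [map_mul, ← IsScalarTower.algebraMap_apply, ← IsScalarTower.algebraMap_apply,
      IsScalarTower.algebraMap_apply B A A' b, hb, map_pow] at h1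
    simp only at hx
    rw [← hx, mul_pow, ← IsScalarTower.algebraMap_apply] at h1
    refine (hu.pow p).mul_right_cancel ?_
    rw [← h1]
    simp

end Localization

end IsSplitRadicial

theorem IsSplitRadicial.isTightlyFRegular {B A : Type u} [CommRing B] [CommRing A] [Algebra B A]
    {p : ℕ} [Fact p.Prime] (h : IsSplitRadicial B A p)
    (hA : IsTightlyFRegular A p) : IsTightlyFRegular B p := by
  intro S I x hx
  let S' := Algebra.algebraMapSubmonoid A S
  have h' : IsSplitRadicial (Localization S) (Localization S') p := h.isLocalization S _ _
  exact h'.mem_of_algebraMap_mem_map (hA S' _ _ (h'.inTightClosure_map hx))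

end SplitRadicial

/-! ### Regular sequences: retracts, extensions and powers -/

section RegularSequences

open RingTheory.Sequence Pointwise

variable {R M M' M'' : Type*} [CommRing R] [AddCommGroup M] [Module R M] [AddCommGroup M']
  [Module R M'] [AddCommGroup M''] [Module R M'']

lemma RingTheory.Sequence.IsWeaklyRegular.of_retract {rs : List R} (h : IsWeaklyRegular M rs)
    (i : M' →ₗ[R] M) (r : M →ₗ[R] M') (hri : r ∘ₗ i = LinearMap.id) : IsWeaklyRegular M' rs := by
  induction rs generalizing M M' with
  | nil => exact .nil R M'
  | cons x rs ih =>
    rw [isWeaklyRegular_cons_iff] at h ⊢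
    refine ⟨h.1.of_injective i (Function.LeftInverse.injective (LinearMap.congr_fun hri)),
      ih h.2 (QuotSMulTop.map x i) (QuotSMulTop.map x r) ?_⟩
    rw [← QuotSMulTop.map_comp, hri, QuotSMulTop.map_id]

lemma RingTheory.Sequence.IsWeaklyRegular.of_exact {rs : List R} {f : M' →ₗ[R] M} {g : M →ₗ[R] M''}
    (hf : Function.Injective f) (hfg : Function.Exact f g) (hg : Function.Surjective g)
    (h' : IsWeaklyRegular M' rs) (h'' : IsWeaklyRegular M'' rs) : IsWeaklyRegular M rs := by
  induction rs generalizing M M' M'' with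
  | nil => exact .nil R M
  | cons x rs ih =>
    rw [isWeaklyRegular_cons_iff] at h' h'' ⊢
    refine ⟨isSMulRegular_of_range_eq_ker hf (LinearMap.exact_iff.1 hfg).symm h'.1 h''.1,
      ih ?_ (QuotSMulTop.map_exact x hfg hg) (QuotSMulTop.map_surjective x hg) h'.2 h''.2⟩
    have := QuotSMulTop.map_first_exact_on_four_term_exact_of_isSMulRegular_last
      ((LinearMap.exact_zero_iff_injective M' f).2 hf) hfg h''.1
    rw [map_zero] at this
    exact (LinearMap.exact_zero_iff_injective _ _).1 this

/-- Induct along `0 → M/x^(n+1) → M/x^(n+2) → M/x → 0`, whose first map is multiplication by `x`; it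
is injective since `x` is regular on `M`. -/
lemma RingTheory.Sequence.IsWeaklyRegular.quotSMulTop_pow {x : R} {rs : List R}
    (hx : IsSMulRegular M x) (h : IsWeaklyRegular (QuotSMulTop x M) rs) (n : ℕ) :
    IsWeaklyRegular (QuotSMulTop (x ^ (n + 1)) M) rs := by
  induction n with
  | zero => rwa [zero_add, pow_one]
  | succ n ih =>
    let f : QuotSMulTop (x ^ (n + 1)) M →ₗ[R] QuotSMulTop (x ^ (n + 1 + 1)) M :=
      Submodule.mapQ _ _ (LinearMap.lsmul R M x) (by
        intro m hm
        obtain ⟨y, -, rfl⟩ := (Submodule.mem_smul_pointwise_iff_exists _ _ _).1 hm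
        refine (Submodule.mem_smul_pointwise_iff_exists _ _ _).2 ⟨y, trivial, ?_⟩
        rw [pow_succ' x (n + 1), mul_smul]; rfl)
    let g : QuotSMulTop (x ^ (n + 1 + 1)) M →ₗ[R] QuotSMulTop x M :=
      Submodule.mapQ _ _ LinearMap.id (by
        intro m hm
        obtain ⟨y, -, rfl⟩ := (Submodule.mem_smul_pointwise_iff_exists _ _ _).1 hm
        refine (Submodule.mem_smul_pointwise_iff_exists _ _ _).2 ⟨x ^ (n + 1) • y, trivial, ?_⟩
        rw [pow_succ' x (n + 1), mul_smul])
    refine IsWeaklyRegular.of_exact (f := f) (g := g) ?_ ?_ ?_ ih h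
    · rw [injective_iff_map_eq_zero]
      intro m hm
      obtain ⟨m, rfl⟩ := Submodule.Quotient.mk_surjective _ m
      obtain ⟨y, -, hy⟩ := (Submodule.mem_smul_pointwise_iff_exists _ _ _).1
        ((Submodule.Quotient.mk_eq_zero _).1 hm)
      rw [pow_succ' x (n + 1), mul_smul] at hy
      exact (Submodule.Quotient.mk_eq_zero _).2
        ((Submodule.mem_smul_pointwise_iff_exists _ _ _).2 ⟨y, trivial, hx hy⟩)
    · intro m
      obtain ⟨m, rfl⟩ := Submodule.Quotient.mk_surjective _ m
      constructor
      · intro hm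
        obtain ⟨y, -, hy⟩ := (Submodule.mem_smul_pointwise_iff_exists _ _ _).1
          ((Submodule.Quotient.mk_eq_zero _).1 hm)
        exact ⟨Submodule.Quotient.mk y, congrArg Submodule.Quotient.mk hy⟩
      · rintro ⟨y, hy⟩
        obtain ⟨y, rfl⟩ := Submodule.Quotient.mk_surjective _ y
        rw [← hy]
        exact (Submodule.Quotient.mk_eq_zero _).2
          ((Submodule.mem_smul_pointwise_iff_exists _ _ _).2 ⟨y, trivial, rfl⟩)
    · intro m
      obtain ⟨m, rfl⟩ := Submodule.Quotient.mk_surjective _ m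
      exact ⟨Submodule.Quotient.mk m, rfl⟩

lemma RingTheory.Sequence.IsWeaklyRegular.map_pow {rs : List R} (h : IsWeaklyRegular M rs) {n : ℕ}
    (hn : 0 < n) : IsWeaklyRegular M (rs.map (· ^ n)) := by
  obtain ⟨n, rfl⟩ := Nat.exists_eq_add_of_lt hn
  rw [zero_add]
  induction rs generalizing M with
  | nil => exact .nil R M
  | cons x rs ih =>
    rw [isWeaklyRegular_cons_iff] at h
    rw [List.map_cons, isWeaklyRegular_cons_iff]
    exact ⟨h.1.pow _, IsWeaklyRegular.quotSMulTop_pow h.1 (ih h.2) n⟩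

lemma localDepth_le_ringKrullDim (R : Type u) [CommRing R] [IsLocalRing R] [IsNoetherianRing R] :
    (localDepth R : WithBot ℕ∞) ≤ ringKrullDim R := by
  obtain ⟨d, hd⟩ : ∃ d : ℕ∞, ringKrullDim R = d :=
    ⟨_, (WithBot.coe_unbot _ ringKrullDim_ne_bot).symm⟩
  rw [hd, WithBot.coe_le_coe]
  refine iSup₂_le fun rs hrs => ?_
  rw [← WithBot.coe_le_coe, ← hd,
    ← ringKrullDim_add_length_eq_ringKrullDim_of_isRegular rs hrs.2]
  have : Nontrivial (R ⧸ Ideal.ofList rs) := by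
    have := hrs.2.top_ne_smul
    rw [smul_eq_mul, Ideal.mul_top] at this
    exact Ideal.Quotient.nontrivial_iff.2 this.symm
  exact le_add_of_nonneg_left ringKrullDim_nonneg_of_nontrivial

end RegularSequences

/-! ### Depth, Cohen–Macaulayness and Serre's conditions -/

namespace IsSplitRadicial

open RingTheory.Sequence

section LocalRing

variable {B A : Type u} [CommRing B] [CommRing A] [Algebra B A] {p : ℕ} [Fact p.Prime]

lemma mem_maximalIdeal [IsLocalRing B] [IsLocalRing A] {a : A}
    (ha : a ∈ IsLocalRing.maximalIdeal A) {b : B} (hb : algebraMap B A b = a ^ p) :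
    b ∈ IsLocalRing.maximalIdeal B := by
  rw [IsLocalRing.mem_maximalIdeal, mem_nonunits_iff] at ha ⊢
  intro h
  have := h.map (algebraMap B A)
  rw [hb] at this
  exact ha ((isUnit_pow_iff (Fact.out : p.Prime).ne_zero).1 this)

variable (h : IsSplitRadicial B A p)
include h

lemma algebraMap_mem_maximalIdeal [IsLocalRing B] [IsLocalRing A] {b : B}
    (hb : b ∈ IsLocalRing.maximalIdeal B) : algebraMap B A b ∈ IsLocalRing.maximalIdeal A := by
  rw [IsLocalRing.mem_maximalIdeal, mem_nonunits_iff] at hb ⊢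
  rintro ⟨v, hv⟩
  obtain ⟨c, hc⟩ := h.exists_algebraMap_eq_pow (↑v⁻¹ : A)
  refine hb ((isUnit_pow_iff (Fact.out : p.Prime).ne_zero).1 (IsUnit.of_mul_eq_one c
    (h.algebraMap_injective ?_)))
  rw [map_mul, map_pow, hc, ← hv, ← mul_pow, v.mul_inv, one_pow, map_one]

/-- Replace a regular sequence of `A` by its `p`-th powers: these come from `B`, stay regular on
`A`, and are regular on the `B`-summand `B` of `A`. -/
lemma localDepth_le [IsLocalRing B] [IsLocalRing A] [IsNoetherianRing B] :
    localDepth A ≤ localDepth B := by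
  refine iSup₂_le fun rs hrs => ?_
  choose φ hφ using h.exists_algebraMap_eq_pow
  obtain ⟨π, hπ⟩ := h.exists_retraction
  have hmem : ∀ x ∈ rs.map φ, x ∈ IsLocalRing.maximalIdeal B := by
    intro x hx
    obtain ⟨a, ha, rfl⟩ := List.mem_map.1 hx
    exact mem_maximalIdeal (hrs.1 a ha) (hφ a)
  have hA : IsWeaklyRegular A (rs.map φ) := by
    rw [← isWeaklyRegular_map_algebraMap_iff A A, List.map_map,
      show algebraMap B A ∘ φ = (· ^ p) from funext hφ]
    exact hrs.2.toIsWeaklyRegular.map_pow (Fact.out : p.Prime).pos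
  have hB : IsWeaklyRegular B (rs.map φ) := hA.of_retract (Algebra.linearMap B A) π
    (LinearMap.ext_ring (by simp [hπ]))
  have hreg : IsRegular B (rs.map φ) :=
    RingTheory.Sequence.IsRegular.of_isWeaklyRegular_of_mem_maximalIdeal B hmem hB
  have := le_iSup₂_of_le (f := fun (rs : List B)
    (_ : (∀ x ∈ rs, x ∈ IsLocalRing.maximalIdeal B) ∧ IsRegular B rs) => (rs.length : ℕ∞))
    (rs.map φ) ⟨hmem, hreg⟩ le_rfl
  rwa [List.length_map] at this

lemma isCohenMacaulayLocal [IsLocalRing B] [IsLocalRing A] [IsNoetherianRing B]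
    (hA : IsCohenMacaulayLocal A) : IsCohenMacaulayLocal B := by
  refine le_antisymm (localDepth_le_ringKrullDim B) ?_
  rw [← h.ringKrullDim_eq, ← hA]
  exact WithBot.coe_le_coe.2 h.localDepth_le

/-- Together with `map_maximalIdeal_le`, this makes the two maximal ideals define the same torsion,
and so comparable local cohomology. -/
lemma exists_maximalIdeal_pow_le [IsLocalRing B] [IsLocalRing A] [IsNoetherianRing A] :
    ∃ k, IsLocalRing.maximalIdeal A ^ k ≤
      (IsLocalRing.maximalIdeal B).map (algebraMap B A) := by
  refine Ideal.exists_pow_le_of_le_radical_of_fg (fun a ha => ?_) (IsNoetherian.noetherian _)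
  obtain ⟨b, hb⟩ := h.exists_algebraMap_eq_pow a
  exact ⟨p, hb ▸ Ideal.mem_map_of_mem _ (mem_maximalIdeal ha hb)⟩

lemma map_maximalIdeal_le [IsLocalRing B] [IsLocalRing A] :
    (IsLocalRing.maximalIdeal B).map (algebraMap B A) ≤ IsLocalRing.maximalIdeal A :=
  Ideal.map_le_iff_le_comap.2 fun _ => h.algebraMap_mem_maximalIdeal

end LocalRing

section AtPrime

variable {B A : Type u} [CommRing B] [CommRing A] [Algebra B A] {p : ℕ} [Fact p.Prime]

/-- Any `a ∉ P` divides `a ^ p`, which comes from `B` outside the contraction of `P`; inverting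
elements of `B` therefore inverts `a`. -/
lemma isLocalization_atPrime (h : IsSplitRadicial B A p) (P : Ideal A) [P.IsPrime] :
    IsLocalization (Algebra.algebraMapSubmonoid A (P.comap (algebraMap B A)).primeCompl)
      (Localization.AtPrime P) := by
  refine (IsLocalization.iff_of_le_of_exists_dvd _ P.primeCompl ?_ fun a ha => ?_).2 inferInstance
  · rintro _ ⟨b, hb, rfl⟩
    exact hb
  · obtain ⟨b, hb⟩ := h.exists_algebraMap_eq_pow a
    refine ⟨a ^ p, ⟨b, ?_, hb⟩, dvd_pow_self a (Fact.out : p.Prime).ne_zero⟩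
    change algebraMap B A b ∉ P
    rw [hb]
    exact fun h => ha (Ideal.IsPrime.mem_of_pow_mem inferInstance p h)

/-- The localization of `B` at a prime ideal is split and radicial in a localization of `A` at a
prime ideal. -/
theorem exists_localization_atPrime (h : IsSplitRadicial B A p) (q : Ideal B) [q.IsPrime] :
    ∃ (P : Ideal A) (_ : P.IsPrime)
      (_ : Algebra (Localization.AtPrime q) (Localization.AtPrime P)),
      IsSplitRadicial (Localization.AtPrime q) (Localization.AtPrime P) p ∧
      ((algebraMap B A).Finite →
        Module.Finite (Localization.AtPrime q) (Localization.AtPrime P)) := by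
  obtain ⟨P, hP, rfl⟩ := h.exists_comap_eq q
  let alg : Algebra (Localization.AtPrime (P.comap (algebraMap B A))) (Localization.AtPrime P) :=
    (Localization.localRingHom _ P (algebraMap B A) rfl).toAlgebra
  have := h.isLocalization_atPrime P
  have : IsScalarTower B (Localization.AtPrime (P.comap (algebraMap B A)))
      (Localization.AtPrime P) := .of_algebraMap_eq fun b => by
    rw [IsScalarTower.algebraMap_apply B A]
    exact (Localization.localRingHom_to_map _ P (algebraMap B A) rfl b).symm
  refine ⟨P, hP, alg, h.isLocalization (P.comap (algebraMap B A)).primeCompl _ _, fun hfin => ?_⟩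
  have : Module.Finite B A := RingHom.finite_algebraMap.1 hfin
  have : IsLocalizedModule (P.comap (algebraMap B A)).primeCompl
      (IsScalarTower.toAlgHom B A (Localization.AtPrime P)).toLinearMap :=
    isLocalizedModule_iff_isLocalization.2 inferInstance
  exact Module.Finite.of_isLocalizedModule (P.comap (algebraMap B A)).primeCompl
    (IsScalarTower.toAlgHom B A (Localization.AtPrime P)).toLinearMap

theorem satisfiesSerre (h : IsSplitRadicial B A p) [IsNoetherianRing B] {r : ℕ}
    (hA : SatisfiesSerre A r) : SatisfiesSerre B r := by
  intro q _
  obtain ⟨P, hP, _, h', -⟩ := h.exists_localization_atPrime q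
  rw [← h'.ringKrullDim_eq]
  exact (hA P).trans (WithBot.coe_le_coe.2 h'.localDepth_le)

end AtPrime

end IsSplitRadicial

/-! ### Comparison of derived-functor `Ext` with `Abelian.Ext` -/

section OldExt

lemma CategoryTheory.conj_comp_of_square {C : Type*} [Category* C] {a₁ a₂ b₁ b₂ c₁ c₂ : C}
    {α : a₁ ≅ b₁} {α' : a₂ ≅ b₂} {β : b₁ ≅ c₁} {β' : b₂ ≅ c₂}
    {f : a₁ ⟶ a₂} {g : b₁ ⟶ b₂} {h : c₁ ⟶ c₂}
    (hf : f ≫ α'.hom = α.hom ≫ g) (hg : g ≫ β'.hom = β.hom ≫ h) :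
    (β.inv ≫ α.inv) ≫ f = h ≫ β'.inv ≫ α'.inv := by
  rw [← cancel_mono α'.hom, ← cancel_mono β'.hom]
  simp [reassoc_of% hf, hg]

variable {R : Type u} [CommRing R] {X X' Y Y' : ModuleCat.{u} R}

/-- Postcomposition with a morphism of modules, as a morphism of complexes `Hom(K, Y) ⟶ Hom(K, Y')`. -/
def ChainComplex.linearYonedaMap (K : ChainComplex (ModuleCat.{u} R) ℕ) (g : Y ⟶ Y') :
    K.linearYonedaObj R Y ⟶ K.linearYonedaObj R Y' :=
  (HomologicalComplex.unopFunctor _ _).map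
    ((NatTrans.mapHomologicalComplex (NatTrans.rightOp ((linearYoneda R _).map g)) _).app K).op

/-- Precomposition with a morphism of complexes, as a morphism of complexes
`Hom(L, Y) ⟶ Hom(K, Y)`. -/
def ChainComplex.linearYonedaPrecomp {K L : ChainComplex (ModuleCat.{u} R) ℕ} (φ : K ⟶ L)
    (Y : ModuleCat.{u} R) : L.linearYonedaObj R Y ⟶ K.linearYonedaObj R Y :=
  (HomologicalComplex.unopFunctor _ _).map
    ((((linearYoneda R (ModuleCat.{u} R)).obj Y).rightOp.mapHomologicalComplex _).map φ).op

namespace CategoryTheory.ProjectiveResolution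

/-- Here `Ext` is a left derived functor valued in the opposite category, so naturality is proved
there and transported back by `Quiver.Hom.op_inj`. -/
lemma isoExt_hom_naturality (P : ProjectiveResolution X) (g : Y ⟶ Y') (n : ℕ) :
    ((_root_.Ext R (ModuleCat.{u} R) n).obj (.op X)).map g ≫ (P.isoExt (R := R) n Y').hom =
      (P.isoExt n Y).hom ≫
        HomologicalComplex.homologyMap (P.complex.linearYonedaMap g) n := by
  have h := P.leftDerived_app_eq (NatTrans.rightOp ((linearYoneda R _).map g)) n
  have h2 := HomologicalComplex.homologyOp_hom_naturality (P.complex.linearYonedaMap g) n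
  apply Quiver.Hom.op_inj
  have h' : (NatTrans.leftDerived (NatTrans.rightOp ((linearYoneda R _).map g)) n).app X ≫
      (P.isoLeftDerivedObj _ n).hom = (P.isoLeftDerivedObj _ n).hom ≫
      (HomologicalComplex.homologyFunctor (ModuleCat R)ᵒᵖ (ComplexShape.down ℕ) n).map
        ((NatTrans.mapHomologicalComplex (NatTrans.rightOp ((linearYoneda R _).map g))
          (ComplexShape.down ℕ)).app P.complex) := by
    rw [h, Category.assoc, Category.assoc, Iso.inv_hom_id, Category.comp_id]
  exact conj_comp_of_square h' h2

lemma isoExt_hom_naturality_left (P : ProjectiveResolution X) (P' : ProjectiveResolution X')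
    {f : X ⟶ X'} (φ : P.Hom P' f) (n : ℕ) (Y : ModuleCat.{u} R) :
    ((_root_.Ext R (ModuleCat.{u} R) n).map f.op).app Y ≫ (P.isoExt (R := R) n Y).hom =
      (P'.isoExt n Y).hom ≫
        HomologicalComplex.homologyMap (ChainComplex.linearYonedaPrecomp φ.hom Y) n := by
  have h := ProjectiveResolution.isoLeftDerivedObj_hom_naturality f P P' φ.hom
    (by rw [φ.hom_f_zero_comp_π_f_zero, ChainComplex.single₀_map_f_zero]; rfl)
    (((linearYoneda R (ModuleCat.{u} R)).obj Y).rightOp) n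
  have h2 := HomologicalComplex.homologyOp_hom_naturality
    (ChainComplex.linearYonedaPrecomp φ.hom Y) n
  apply Quiver.Hom.op_inj
  exact (conj_comp_of_square h h2)

end CategoryTheory.ProjectiveResolution

section Reps

variable (K L : CochainComplex (ModuleCat.{u} R) ℕ) {n : ℕ}

/-- The cocycle `x` represents the cohomology class `α`. -/
def CochainComplex.Represents (x : K.X n) (α : K.homology n) : Prop :=
  ∃ z : K.cycles n, K.iCycles n z = x ∧ K.homologyπ n z = α

namespace CochainComplex.Represents
variable {K L} {x : K.X n} {α : K.homology n}

lemma exists_cocycle (α : K.homology n) : ∃ x : K.X n, K.d n (n + 1) x = 0 ∧ K.Represents x α := by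
  obtain ⟨z, rfl⟩ := (ModuleCat.epi_iff_surjective (K.homologyπ n)).1 inferInstance α
  refine ⟨K.iCycles n z, ?_, z, rfl, rfl⟩
  rw [← ConcreteCategory.comp_apply, K.iCycles_d]
  rfl

lemma exists_class (h : K.d n (n + 1) x = 0) : ∃ α, K.Represents x α := by
  have hex := ShortComplex.exact_of_f_is_kernel
    (.mk _ _ (K.iCycles_d n (n + 1))) (K.cyclesIsKernel n (n + 1) (by simp))
  obtain ⟨z, hz⟩ := (ShortComplex.moduleCat_exact_iff _).1 hex x h
  exact ⟨_, z, hz, rfl⟩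

lemma eq_zero_iff (h : K.Represents x α) {i : ℕ} (hi : (ComplexShape.up ℕ).prev n = i) :
    α = 0 ↔ ∃ y : K.X i, K.d i n y = x := by
  obtain ⟨z, rfl, rfl⟩ := h
  have hex := ShortComplex.exact_of_g_is_cokernel
    (.mk _ _ (K.toCycles_comp_homologyπ i n)) (K.homologyIsCokernel i n hi)
  have hinj := (ModuleCat.mono_iff_injective (K.iCycles n)).1 inferInstance
  have hd (y : K.X i) : K.iCycles n (K.toCycles i n y) = K.d i n y := by
    rw [← ConcreteCategory.comp_apply, K.toCycles_i]
  constructor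
  · intro h0
    obtain ⟨y, hy⟩ := (ShortComplex.moduleCat_exact_iff _).1 hex z h0
    exact ⟨y, by rw [← hd]; exact congrArg _ hy⟩
  · rintro ⟨y, hy⟩
    rw [← hinj ((hd y).trans hy), ← ConcreteCategory.comp_apply, K.toCycles_comp_homologyπ]
    rfl

lemma map (h : K.Represents x α) (φ : K ⟶ L) :
    L.Represents (φ.f n x) (HomologicalComplex.homologyMap φ n α) := by
  obtain ⟨z, rfl, rfl⟩ := h
  refine ⟨HomologicalComplex.cyclesMap φ n z, ?_, ?_⟩
  · rw [← ConcreteCategory.comp_apply, HomologicalComplex.cyclesMap_i]; rfl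
  · rw [← ConcreteCategory.comp_apply, ← HomologicalComplex.homologyπ_naturality]; rfl

end CochainComplex.Represents
end Reps

section Comparison

open Abelian

lemma CategoryTheory.ProjectiveResolution.extMk_zero_eq_zero_iff {C : Type*} [Category* C]
    [Abelian C] [HasExt C] {X Y : C} (P : ProjectiveResolution X) (f : P.complex.X 0 ⟶ Y)
    (hf : P.complex.d 1 0 ≫ f = 0) : P.extMk f 1 rfl hf = 0 ↔ f = 0 := by
  refine ⟨fun h => ?_, fun h => by subst h; simp⟩
  rw [← P.extEquivCohomologyClass.apply_eq_iff_eq, extEquivCohomologyClass_extMk,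
    extEquivCohomologyClass_zero, CochainComplex.HomComplex.CohomologyClass.mk_eq_zero_iff,
    CochainComplex.HomComplex.Cocycle.toSingleMk_mem_coboundaries_iff _ _ _ _ _ 1 (by simp)] at h
  obtain ⟨g, hg⟩ := h
  rw [← cancel_epi (P.cochainComplexXIso 0 0 rfl).hom, Limits.comp_zero]
  refine hg.symm.trans ?_
  -- The resolution is zero in cohomological degree `1`, so the only coboundary here is zero.
  rw [(P.cochainComplex.isZero_of_isStrictlyLE 0 1 (by simp)).eq_of_src g 0, Limits.comp_zero]

/-- An element of the `Ext` module defined by left derivation and an element of the `Ext` group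
defined by the derived category correspond to each other if they are given by a common cocycle on
the chosen projective resolution. -/
def ExtCorresponds {n : ℕ} (α : ((_root_.Ext R (ModuleCat.{u} R) n).obj (.op X)).obj Y)
    (β : Abelian.Ext.{u} X Y n) : Prop :=
  ∃ (f : (projectiveResolution X).complex.X n ⟶ Y)
    (hf : (projectiveResolution X).complex.d (n + 1) n ≫ f = 0),
    ((projectiveResolution X).complex.linearYonedaObj R Y).Represents f
      (((projectiveResolution X).isoExt n Y).hom α) ∧
    (projectiveResolution X).extMk f (n + 1) rfl hf = β

namespace ExtCorresponds

variable {n : ℕ} {α : ((_root_.Ext R (ModuleCat.{u} R) n).obj (.op X)).obj Y}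
  {β : Abelian.Ext.{u} X Y n}

lemma exists_right (α : ((_root_.Ext R (ModuleCat.{u} R) n).obj (.op X)).obj Y) :
    ∃ β, ExtCorresponds α β := by
  obtain ⟨f, hf, h⟩ := CochainComplex.Represents.exists_cocycle
    (((projectiveResolution X).isoExt n Y).hom α)
  exact ⟨_, f, hf, h, rfl⟩

lemma exists_left (β : Abelian.Ext.{u} X Y n) :
    ∃ α : ((_root_.Ext R (ModuleCat.{u} R) n).obj (.op X)).obj Y, ExtCorresponds α β := by
  obtain ⟨f, hf, rfl⟩ := (projectiveResolution X).extMk_surjective β (n + 1) rfl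
  obtain ⟨α, h⟩ := CochainComplex.Represents.exists_class
    (K := (projectiveResolution X).complex.linearYonedaObj R Y) (x := f) hf
  refine ⟨((projectiveResolution X).isoExt n Y).inv α, f, hf, ?_, rfl⟩
  simpa using h

/-- Either class vanishes exactly when the common cocycle is a coboundary. Only vanishing is ever
compared, so a relation does the work of an isomorphism. -/
lemma eq_zero_iff (h : ExtCorresponds α β) : α = 0 ↔ β = 0 := by
  obtain ⟨f, hf, h, rfl⟩ := h
  have hinj : Function.Injective ((projectiveResolution X).isoExt (R := R) n Y).hom :=
    (ModuleCat.mono_iff_injective _).1 inferInstance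
  have h0 : α = 0 ↔ ((projectiveResolution X).isoExt n Y).hom α = 0 :=
    ⟨fun h => by rw [h, map_zero], fun h => hinj (h.trans (map_zero _).symm)⟩
  rw [h0]
  cases n with
  | zero =>
    rw [ProjectiveResolution.extMk_zero_eq_zero_iff, h.eq_zero_iff CochainComplex.prev_nat_zero,
      HomologicalComplex.shape _ _ _ (by simp)]
    exact ⟨fun ⟨y, hy⟩ => hy.symm, fun h => ⟨0, h.symm⟩⟩
  | succ n =>
    rw [ProjectiveResolution.extMk_eq_zero_iff _ _ _ _ _ n rfl,
      h.eq_zero_iff (CochainComplex.prev_nat_succ n)]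
    rfl

lemma map_right (h : ExtCorresponds α β) (g : Y ⟶ Y') :
    ExtCorresponds (((_root_.Ext R (ModuleCat.{u} R) n).obj (.op X)).map g α)
      (β.comp (Abelian.Ext.mk₀ g) (add_zero n)) := by
  obtain ⟨f, hf, h, rfl⟩ := h
  refine ⟨f ≫ g, by rw [reassoc_of% hf, Limits.zero_comp], ?_,
    (ProjectiveResolution.extMk_comp_mk₀ _ _ _ _ _ _).symm⟩
  rw [← ConcreteCategory.comp_apply, ProjectiveResolution.isoExt_hom_naturality]
  exact h.map (ChainComplex.linearYonedaMap _ g)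

lemma map_left (h : ExtCorresponds α β) (g : X' ⟶ X) :
    ExtCorresponds (((_root_.Ext R (ModuleCat.{u} R) n).map g.op).app Y α)
      ((Abelian.Ext.mk₀ g).comp β (zero_add n)) := by
  obtain ⟨f, hf, h, rfl⟩ := h
  let φ : (projectiveResolution X').Hom (projectiveResolution X) g :=
    ⟨ProjectiveResolution.lift g _ _, by
      rw [ProjectiveResolution.lift_commutes_zero, ChainComplex.single₀_map_f_zero]; rfl⟩
  refine ⟨φ.hom.f n ≫ f, by rw [← φ.hom.comm_assoc, hf, Limits.comp_zero], ?_,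
    (ProjectiveResolution.mk₀_comp_extMk _ _ _ _ φ).symm⟩
  rw [← ConcreteCategory.comp_apply, ProjectiveResolution.isoExt_hom_naturality_left _ _ φ]
  exact h.map (ChainComplex.linearYonedaPrecomp φ.hom Y)

end ExtCorresponds
end Comparison
end OldExt

/-! ### Injectivity on local cohomology in terms of `Ext^i(R ⧸ I ^ n, -)` -/

section LocalCohomologyCriterion

open Abelian

variable {R : Type u} [CommRing R]

namespace localCohomology

/-- The transition map `R ⧸ I ^ n → R ⧸ I ^ m` for `m ≤ n`. -/
def quotPowMap (I : Ideal R) {m n : ℕ} (h : m ≤ n) :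
    ModuleCat.of R (R ⧸ I ^ n) ⟶ ModuleCat.of R (R ⧸ I ^ m) :=
  (ringModIdeals (idealPowersDiagram I)).map (homOfLE h).op

lemma quotPowMap_mk (I : Ideal R) {m n : ℕ} (h : m ≤ n) (r : R) :
    quotPowMap I h (Ideal.Quotient.mk _ r) = Ideal.Quotient.mk _ r := rfl

lemma quotPowMap_comp (I : Ideal R) {l m n : ℕ} (h : l ≤ m) (h' : m ≤ n) :
    quotPowMap I h' ≫ quotPowMap I h = quotPowMap I (h.trans h') :=
  ((ringModIdeals (idealPowersDiagram I)).map_comp _ _).symm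

/-- Every element of the kernel of `Ext^i(R ⧸ I ^ n, M) → Ext^i(R ⧸ I ^ n, N)` vanishes in
`Ext^i(R ⧸ I ^ m, M)` for some `m ≥ n`. -/
def EventuallyInjective (I : Ideal R) (i : ℕ) {M N : ModuleCat.{u} R} (f : M ⟶ N) : Prop :=
  ∀ (n : ℕ) (β : Abelian.Ext.{u} (ModuleCat.of R (R ⧸ I ^ n)) M i),
    β.comp (Abelian.Ext.mk₀ f) (add_zero i) = 0 →
      ∃ (m : ℕ) (h : n ≤ m), (Abelian.Ext.mk₀ (quotPowMap I h)).comp β (zero_add i) = 0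

/-- Every element of `Ext^i(R ⧸ I ^ n, M)` vanishes in `Ext^i(R ⧸ I ^ m, M)` for some `m ≥ n`. -/
def EventuallyZero (I : Ideal R) (i : ℕ) (M : ModuleCat.{u} R) : Prop :=
  ∀ (n : ℕ) (β : Abelian.Ext.{u} (ModuleCat.of R (R ⧸ I ^ n)) M i),
    ∃ (m : ℕ) (h : n ≤ m), (Abelian.Ext.mk₀ (quotPowMap I h)).comp β (zero_add i) = 0

variable {I : Ideal R} {i : ℕ} {M N : ModuleCat.{u} R}

/-- Local cohomology of `M` is the colimit of the modules `Ext^i(R ⧸ I ^ n, M)`. -/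
def isColimitEval (I : Ideal R) (i : ℕ) (M : ModuleCat.{u} R) :
    Limits.IsColimit (((evaluation _ _).obj M).mapCocone
      (Limits.colimit.cocone (diagram (idealPowersDiagram I) i))) :=
  Limits.isColimitOfPreserves _ (Limits.colimit.isColimit _)

/-- The map from `Ext^i(R ⧸ I ^ n, M)` to local cohomology. -/
def fromExt (I : Ideal R) (i : ℕ) (M : ModuleCat.{u} R) (n : ℕ) :
    ((_root_.Ext R (ModuleCat.{u} R) i).obj (.op (.of R (R ⧸ I ^ n)))).obj M ⟶
      (localCohomology I i).obj M :=
  (Limits.colimit.ι (diagram (idealPowersDiagram I) i) (.op (.op n))).app M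

instance preservesColimit_forget (F : ℕᵒᵖᵒᵖ ⥤ ModuleCat.{u} R) :
    Limits.PreservesColimit F (forget (ModuleCat.{u} R)) := by
  have : Limits.PreservesFilteredColimitsOfSize.{0, 0} (forget (ModuleCat.{u} R)) :=
    Limits.preservesFilteredColimitsOfSize_shrink.{0, u, 0, u} _
  infer_instance

lemma exists_map_eq_zero {F : ℕᵒᵖᵒᵖ ⥤ ModuleCat.{u} R} {c : Limits.Cocone F}
    (hc : Limits.IsColimit c) {n : ℕ} {x : F.obj (.op (.op n))}
    (h : c.ι.app (.op (.op n)) x = 0) :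
    ∃ (m : ℕ) (h : n ≤ m), F.map (homOfLE h).op.op x = 0 := by
  obtain ⟨k, f, g, h⟩ := Limits.Concrete.isColimit_exists_of_rep_eq F hc x
    (0 : F.obj (.op (.op n))) (h.trans (map_zero _).symm)
  exact ⟨k.unop.unop, leOfHom f.unop.unop, h.trans (map_zero _)⟩

lemma exists_fromExt_eq (x : (localCohomology I i).obj M) :
    ∃ n α, fromExt I i M n α = x := by
  obtain ⟨j, y, h⟩ := Limits.Concrete.isColimit_exists_rep _ (isColimitEval I i M) x
  exact ⟨j.unop.unop, y, h⟩

lemma fromExt_naturality (f : M ⟶ N) (n : ℕ) :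
    fromExt I i M n ≫ (localCohomology I i).map f =
      ((_root_.Ext R (ModuleCat.{u} R) i).obj _).map f ≫ fromExt I i N n :=
  ((Limits.colimit.ι (diagram (idealPowersDiagram I) i) (.op (.op n))).naturality f).symm

lemma quotPowMap_fromExt {m n : ℕ} (h : n ≤ m) :
    ((_root_.Ext R (ModuleCat.{u} R) i).map (quotPowMap I h).op).app M ≫ fromExt I i M m =
      fromExt I i M n :=
  congrArg (fun t => t.app M)
    (Limits.colimit.w (diagram (idealPowersDiagram I) i) (homOfLE h).op.op)

lemma fromExt_eq_zero_iff {n : ℕ}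
    (α : ((_root_.Ext R (ModuleCat.{u} R) i).obj (.op (.of R (R ⧸ I ^ n)))).obj M) :
    fromExt I i M n α = 0 ↔ ∃ (m : ℕ) (h : n ≤ m),
      ((_root_.Ext R (ModuleCat.{u} R) i).map (quotPowMap I h).op).app M α = 0 := by
  constructor
  · intro h
    exact exists_map_eq_zero (isColimitEval I i M) h
  · rintro ⟨m, h, h0⟩
    have := ConcreteCategory.congr_hom (quotPowMap_fromExt (I := I) (i := i) (M := M) h) α
    rw [← this, ConcreteCategory.comp_apply]
    exact (congrArg _ h0).trans (map_zero _)

/-- In a filtered colimit every element comes from a finite stage, and one that vanishes already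
does so at a later stage. This trades colimits for `Abelian.Ext`, with its long exact sequences. -/
theorem injective_map_iff (f : M ⟶ N) :
    Function.Injective ((localCohomology I i).map f) ↔ EventuallyInjective I i f := by
  rw [injective_iff_map_eq_zero]
  constructor
  · intro H n β hβ
    obtain ⟨α, hα⟩ := ExtCorresponds.exists_left β
    have h0 := (hα.map_right f).eq_zero_iff.2 hβ
    have h1 := H (fromExt I i M n α) (by
      rw [← ConcreteCategory.comp_apply, fromExt_naturality, ConcreteCategory.comp_apply]
      erw [h0]
      rw [map_zero])
    obtain ⟨m, h, h2⟩ := (fromExt_eq_zero_iff α).1 h1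
    exact ⟨m, h, (hα.map_left _).eq_zero_iff.1 h2⟩
  · intro H x hx
    obtain ⟨n, α, rfl⟩ := exists_fromExt_eq x
    rw [← ConcreteCategory.comp_apply, fromExt_naturality, ConcreteCategory.comp_apply,
      fromExt_eq_zero_iff] at hx
    obtain ⟨m, h, h0⟩ := hx
    obtain ⟨β, hβ⟩ := ExtCorresponds.exists_right α
    have h1 := (((hβ.map_right f).map_left (quotPowMap I h)).eq_zero_iff.1 h0)
    obtain ⟨l, h', h2⟩ := H m ((Abelian.Ext.mk₀ (quotPowMap I h)).comp β (zero_add i)) (by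
      rw [Abelian.Ext.comp_assoc_of_third_deg_zero]; exact h1)
    rw [fromExt_eq_zero_iff]
    refine ⟨l, h.trans h', (hβ.map_left _).eq_zero_iff.2 ?_⟩
    rw [← quotPowMap_comp I h h', ← Abelian.Ext.mk₀_comp_mk₀,
      Abelian.Ext.comp_assoc_of_second_deg_zero]
    exact h2

end localCohomology
end LocalCohomologyCriterion

/-! ### Dimension shifting -/

section DimensionShift

open Abelian

variable {R : Type u} [CommRing R]

namespace localCohomology

variable {I : Ideal R} {i : ℕ} {M N : ModuleCat.{u} R}

/-- An element of a module is `I`-torsion if it is annihilated by a power of `I`. -/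
def IsPowTorsion (I : Ideal R) {M : Type*} [AddCommGroup M] [Module R M] (x : M) : Prop :=
  ∃ n : ℕ, ∀ a ∈ I ^ n, a • x = 0

/-- The map `R ⧸ I ^ n → M` sending `1` to an element annihilated by `I ^ n`. -/
def homOfTorsion {n : ℕ} (x : M) (hx : ∀ a ∈ I ^ n, a • x = 0) :
    ModuleCat.of R (R ⧸ I ^ n) ⟶ M :=
  ModuleCat.ofHom (Submodule.liftQ (I ^ n) (LinearMap.toSpanSingleton R M x) hx)

lemma homOfTorsion_one {n : ℕ} (x : M) (hx : ∀ a ∈ I ^ n, a • x = 0) :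
    homOfTorsion x hx (Ideal.Quotient.mk _ 1) = x := one_smul R x

lemma hom_quotPow_ext {n : ℕ} {f g : ModuleCat.of R (R ⧸ I ^ n) ⟶ M}
    (h : f (Ideal.Quotient.mk _ 1) = g (Ideal.Quotient.mk _ 1)) : f = g := by
  refine ModuleCat.hom_ext (LinearMap.ext fun x => ?_)
  obtain ⟨r, rfl⟩ := Ideal.Quotient.mk_surjective x
  have hr : Ideal.Quotient.mk (I ^ n) r = r • (Ideal.Quotient.mk (I ^ n) 1) := by
    rw [← Ideal.Quotient.mkₐ_eq_mk R, ← map_smul]; simp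
  change f _ = g _
  rw [hr, map_smul, map_smul, h]

lemma isPowTorsion_of_hom {n : ℕ} (f : ModuleCat.of R (R ⧸ I ^ n) ⟶ M) :
    ∀ a ∈ I ^ n, a • f (Ideal.Quotient.mk _ 1) = 0 := by
  intro a ha
  rw [← map_smul]
  have : a • (Ideal.Quotient.mk (I ^ n) 1) = 0 := by
    rw [← Ideal.Quotient.mkₐ_eq_mk R, ← map_smul]
    simpa using Ideal.Quotient.eq_zero_iff_mem.2 ha
  exact (congrArg f this).trans (map_zero _)

lemma quotPowMap_comp_assoc {X : ModuleCat.{u} R} {l m n : ℕ} (h : l ≤ m) (h' : m ≤ n)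
    (β : Abelian.Ext.{u} (ModuleCat.of R (R ⧸ I ^ l)) X i) :
    (Abelian.Ext.mk₀ (quotPowMap I (h.trans h'))).comp β (zero_add i) =
      (Abelian.Ext.mk₀ (quotPowMap I h')).comp
        ((Abelian.Ext.mk₀ (quotPowMap I h)).comp β (zero_add i)) (zero_add i) := by
  rw [← quotPowMap_comp I h h', ← Abelian.Ext.mk₀_comp_mk₀,
    Abelian.Ext.comp_assoc_of_second_deg_zero]

lemma eventuallyInjective_zero_iff (f : M ⟶ N) :
    EventuallyInjective I 0 f ↔ ∀ x : M, IsPowTorsion I x → f x = 0 → x = 0 := by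
  constructor
  · rintro H x ⟨n, hx⟩ h0
    obtain ⟨m, h, h1⟩ := H n (Abelian.Ext.mk₀ (homOfTorsion x hx)) (by
      rw [Abelian.Ext.mk₀_comp_mk₀, Abelian.Ext.mk₀_eq_zero_iff]
      apply hom_quotPow_ext
      rw [ConcreteCategory.comp_apply, homOfTorsion_one, h0]; rfl)
    rw [Abelian.Ext.mk₀_comp_mk₀, Abelian.Ext.mk₀_eq_zero_iff] at h1
    have := ConcreteCategory.congr_hom h1 (Ideal.Quotient.mk _ 1)
    rw [ConcreteCategory.comp_apply, quotPowMap_mk, homOfTorsion_one] at this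
    exact this
  · intro H n β hβ
    obtain ⟨b, rfl⟩ := (Abelian.Ext.mk₀_bijective _ _).2 β
    rw [Abelian.Ext.mk₀_comp_mk₀, Abelian.Ext.mk₀_eq_zero_iff] at hβ
    refine ⟨n, le_rfl, ?_⟩
    have hb : b = 0 := hom_quotPow_ext (H _ ⟨n, isPowTorsion_of_hom b⟩
      (ConcreteCategory.congr_hom hβ (Ideal.Quotient.mk _ 1)))
    rw [hb, Abelian.Ext.mk₀_zero, Abelian.Ext.comp_zero]

lemma EventuallyZero.of_injective (M : ModuleCat.{u} R) [Injective M] :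
    EventuallyZero I (i + 1) M :=
  fun n β => ⟨n, le_rfl, by rw [Abelian.Ext.eq_zero_of_injective β, Abelian.Ext.comp_zero]⟩

lemma EventuallyZero.of_retract (r : Retract M N) (h : EventuallyZero I i N) :
    EventuallyZero I i M := by
  intro n β
  obtain ⟨m, hm, h0⟩ := h n (β.comp (Abelian.Ext.mk₀ r.i) (add_zero i))
  refine ⟨m, hm, ?_⟩
  have := congrArg (fun t => t.comp (Abelian.Ext.mk₀ r.r) (add_zero i)) h0
  simpa [Abelian.Ext.comp_assoc_of_third_deg_zero] using this

section

variable {S S' : ShortComplex (ModuleCat.{u} R)} (hS : S.ShortExact) (hS' : S'.ShortExact)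
  (φ : S ⟶ S')

include hS

/-- After restriction to a later stage, a class on `S.X₁` dies in `S.X₂`, so it is the boundary of a
class on `S.X₃`, which itself dies later. -/
lemma EventuallyZero.shift (h₃ : EventuallyZero I i S.X₃)
    (h₂ : EventuallyZero I (i + 1) S.X₂) : EventuallyZero I (i + 1) S.X₁ := by
  intro n β
  obtain ⟨m, hm, h0⟩ := h₂ n (β.comp (Abelian.Ext.mk₀ S.f) (add_zero _))
  rw [← Abelian.Ext.comp_assoc_of_third_deg_zero] at h0
  obtain ⟨γ, hγ⟩ := Abelian.Ext.covariant_sequence_exact₁ _ hS _ h0 rfl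
  obtain ⟨l, hl, h1⟩ := h₃ m γ
  refine ⟨l, hm.trans hl, ?_⟩
  rw [quotPowMap_comp_assoc hm hl, ← hγ, ← Abelian.Ext.comp_assoc _ _ _ (zero_add i) rfl (by lia), h1,
    Abelian.Ext.zero_comp]

/-- In degree `0` classes on `S.X₃` are torsion elements and need not die; lifting them to torsion
elements of `S.X₂` kills their boundaries instead. -/
lemma EventuallyZero.shift_one
    (h₃ : ∀ c : S.X₃, IsPowTorsion I c → ∃ e : S.X₂, IsPowTorsion I e ∧ S.g e = c)
    (h₂ : EventuallyZero I 1 S.X₂) : EventuallyZero I 1 S.X₁ := by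
  intro n β
  obtain ⟨m, hm, h0⟩ := h₂ n (β.comp (Abelian.Ext.mk₀ S.f) (add_zero _))
  rw [← Abelian.Ext.comp_assoc_of_third_deg_zero] at h0
  obtain ⟨γ, hγ⟩ := Abelian.Ext.covariant_sequence_exact₁ _ hS _ h0 (zero_add 1)
  obtain ⟨c, rfl⟩ := (Abelian.Ext.mk₀_bijective _ _).2 γ
  obtain ⟨e, ⟨k, hk⟩, he⟩ := h₃ _ ⟨m, isPowTorsion_of_hom c⟩
  have hk' : ∀ a ∈ I ^ (max m k), a • e = 0 :=
    fun a ha => hk a (Ideal.pow_le_pow_right (le_max_right _ _) ha)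
  have hc : quotPowMap I (le_max_left m k) ≫ c = homOfTorsion e hk' ≫ S.g := by
    apply hom_quotPow_ext
    rw [ConcreteCategory.comp_apply, ConcreteCategory.comp_apply, homOfTorsion_one, he,
      quotPowMap_mk]
  refine ⟨max m k, hm.trans (le_max_left _ _), ?_⟩
  rw [quotPowMap_comp_assoc hm (le_max_left _ _), ← hγ,
    ← Abelian.Ext.comp_assoc _ _ _ (zero_add 0) (zero_add 1) (by lia), Abelian.Ext.mk₀_comp_mk₀,
    hc, ← Abelian.Ext.mk₀_comp_mk₀, Abelian.Ext.comp_assoc _ _ _ (zero_add 0) (zero_add 1) (by lia),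
    hS.comp_extClass, Abelian.Ext.comp_zero]

include hS'

lemma comp_extClass_comp_τ₁ {X : ModuleCat.{u} R} (γ : Abelian.Ext.{u} X S.X₃ i) :
    (γ.comp hS.extClass rfl).comp (Abelian.Ext.mk₀ φ.τ₁) (add_zero _) =
      (γ.comp (Abelian.Ext.mk₀ φ.τ₃) (add_zero _)).comp hS'.extClass rfl := by
  rw [Abelian.Ext.comp_assoc_of_third_deg_zero, hS.extClass_naturality hS' φ,
    Abelian.Ext.comp_assoc_of_second_deg_zero]

lemma EventuallyInjective.shift_τ₃ (h : EventuallyInjective I (i + 1) φ.τ₁)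
    (h₂ : EventuallyZero I i S.X₂) : EventuallyInjective I i φ.τ₃ := by
  intro n γ hγ
  obtain ⟨m, hm, h0⟩ := h n (γ.comp hS.extClass rfl) (by
    rw [comp_extClass_comp_τ₁ hS hS', hγ, Abelian.Ext.zero_comp])
  rw [← Abelian.Ext.comp_assoc _ _ _ (zero_add i) rfl (by lia)] at h0
  obtain ⟨β, hβ⟩ := Abelian.Ext.covariant_sequence_exact₃ _ hS _ _ h0
  obtain ⟨l, hl, h1⟩ := h₂ m β
  refine ⟨l, hm.trans hl, ?_⟩
  rw [quotPowMap_comp_assoc hm hl, ← hβ, ← Abelian.Ext.comp_assoc_of_third_deg_zero, h1,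
    Abelian.Ext.zero_comp]

/-- Eventually `α` is the boundary of some `γ` on `S.X₃`. As `α` dies under `φ.τ₁`, the image of `γ`
comes from `S'.X₂` and dies later; then `γ` dies by `h`, and `α` with it. -/
lemma EventuallyInjective.shift_τ₁ (h : EventuallyInjective I i φ.τ₃)
    (h₂ : EventuallyZero I (i + 1) S.X₂) (h₂' : EventuallyZero I i S'.X₂) :
    EventuallyInjective I (i + 1) φ.τ₁ := by
  intro n α hα
  obtain ⟨m, hm, h0⟩ := h₂ n (α.comp (Abelian.Ext.mk₀ S.f) (add_zero _))
  rw [← Abelian.Ext.comp_assoc_of_third_deg_zero] at h0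
  obtain ⟨γ, hγ⟩ := Abelian.Ext.covariant_sequence_exact₁ _ hS _ h0 rfl
  have h1 := comp_extClass_comp_τ₁ hS hS' φ γ
  rw [hγ, Abelian.Ext.comp_assoc_of_third_deg_zero, hα, Abelian.Ext.comp_zero] at h1
  obtain ⟨β, hβ⟩ := Abelian.Ext.covariant_sequence_exact₃ _ hS' _ _ h1.symm
  obtain ⟨l, hl, h2⟩ := h₂' m β
  obtain ⟨k, hk, h3⟩ := h l ((Abelian.Ext.mk₀ (quotPowMap I hl)).comp γ (zero_add i)) (by
    rw [Abelian.Ext.comp_assoc_of_third_deg_zero, ← hβ,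
      ← Abelian.Ext.comp_assoc_of_third_deg_zero, h2, Abelian.Ext.zero_comp])
  refine ⟨k, (hm.trans hl).trans hk, ?_⟩
  rw [quotPowMap_comp_assoc (hm.trans hl) hk, quotPowMap_comp_assoc hm hl, ← hγ,
    ← Abelian.Ext.comp_assoc _ _ _ (zero_add i) rfl (by lia),
    ← Abelian.Ext.comp_assoc _ _ _ (zero_add i) rfl (by lia), h3, Abelian.Ext.zero_comp]

/-- Morally `H^1(S.X₁)` is the cokernel of `Γ_I(S.X₂) → Γ_I(S.X₃)`. The resulting criterion mentions
torsion elements only, so it can be moved between rings. -/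
lemma eventuallyInjective_one_iff (h₂ : EventuallyZero I 1 S.X₂) :
    EventuallyInjective I 1 φ.τ₁ ↔ ∀ c : S.X₃, IsPowTorsion I c →
      (∃ e : S'.X₂, IsPowTorsion I e ∧ S'.g e = φ.τ₃ c) →
        ∃ e : S.X₂, IsPowTorsion I e ∧ S.g e = c := by
  constructor
  · rintro h c ⟨n, hn⟩ ⟨e, ⟨k, hk⟩, he⟩
    have hn' : ∀ a ∈ I ^ (max n k), a • c = 0 :=
      fun a ha => hn a (Ideal.pow_le_pow_right (le_max_left _ _) ha)
    have hk' : ∀ a ∈ I ^ (max n k), a • e = 0 :=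
      fun a ha => hk a (Ideal.pow_le_pow_right (le_max_right _ _) ha)
    have hce : homOfTorsion c hn' ≫ φ.τ₃ = homOfTorsion e hk' ≫ S'.g := by
      apply hom_quotPow_ext
      rw [ConcreteCategory.comp_apply, ConcreteCategory.comp_apply, homOfTorsion_one,
        homOfTorsion_one, he]
    obtain ⟨m, hm, h0⟩ := h _
      ((Abelian.Ext.mk₀ (homOfTorsion c hn')).comp hS.extClass (zero_add 1)) (by
        rw [comp_extClass_comp_τ₁ hS hS', Abelian.Ext.mk₀_comp_mk₀, hce,
          ← Abelian.Ext.mk₀_comp_mk₀,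
          Abelian.Ext.comp_assoc _ _ _ (zero_add 0) (zero_add 1) (by lia), hS'.comp_extClass,
          Abelian.Ext.comp_zero])
    rw [← Abelian.Ext.comp_assoc _ _ _ (zero_add 0) (zero_add 1) (by lia),
      Abelian.Ext.mk₀_comp_mk₀] at h0
    obtain ⟨β, hβ⟩ := Abelian.Ext.covariant_sequence_exact₃ _ hS _ _ h0
    obtain ⟨b, rfl⟩ := (Abelian.Ext.mk₀_bijective _ _).2 β
    rw [Abelian.Ext.mk₀_comp_mk₀] at hβ
    have hb := ConcreteCategory.congr_hom ((Abelian.Ext.mk₀_bijective _ _).1 hβ)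
      (Ideal.Quotient.mk _ 1)
    rw [ConcreteCategory.comp_apply, ConcreteCategory.comp_apply, quotPowMap_mk,
      homOfTorsion_one] at hb
    exact ⟨_, ⟨m, isPowTorsion_of_hom b⟩, hb⟩
  · intro h n α hα
    obtain ⟨m, hm, h0⟩ := h₂ n (α.comp (Abelian.Ext.mk₀ S.f) (add_zero _))
    rw [← Abelian.Ext.comp_assoc_of_third_deg_zero] at h0
    obtain ⟨γ, hγ⟩ := Abelian.Ext.covariant_sequence_exact₁ _ hS _ h0 (zero_add 1)
    have h1 := comp_extClass_comp_τ₁ hS hS' φ γ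
    rw [hγ, Abelian.Ext.comp_assoc_of_third_deg_zero, hα, Abelian.Ext.comp_zero] at h1
    obtain ⟨β, hβ⟩ := Abelian.Ext.covariant_sequence_exact₃ _ hS' _ _ h1.symm
    obtain ⟨c, rfl⟩ := (Abelian.Ext.mk₀_bijective _ _).2 γ
    obtain ⟨b, rfl⟩ := (Abelian.Ext.mk₀_bijective _ _).2 β
    rw [Abelian.Ext.mk₀_comp_mk₀, Abelian.Ext.mk₀_comp_mk₀] at hβ
    have hb := ConcreteCategory.congr_hom ((Abelian.Ext.mk₀_bijective _ _).1 hβ)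
      (Ideal.Quotient.mk _ 1)
    obtain ⟨e, ⟨k, hk⟩, he⟩ := h _ ⟨m, isPowTorsion_of_hom c⟩ ⟨_, ⟨m, isPowTorsion_of_hom b⟩, hb⟩
    have hk' : ∀ a ∈ I ^ (max m k), a • e = 0 :=
      fun a ha => hk a (Ideal.pow_le_pow_right (le_max_right _ _) ha)
    have hc : quotPowMap I (le_max_left m k) ≫ c = homOfTorsion e hk' ≫ S.g := by
      apply hom_quotPow_ext
      rw [ConcreteCategory.comp_apply, ConcreteCategory.comp_apply, homOfTorsion_one, he,
        quotPowMap_mk]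
    refine ⟨max m k, hm.trans (le_max_left _ _), ?_⟩
    rw [quotPowMap_comp_assoc hm (le_max_left _ _), ← hγ,
      ← Abelian.Ext.comp_assoc _ _ _ (zero_add 0) (zero_add 1) (by lia),
      Abelian.Ext.mk₀_comp_mk₀, hc, ← Abelian.Ext.mk₀_comp_mk₀,
      Abelian.Ext.comp_assoc _ _ _ (zero_add 0) (zero_add 1) (by lia), hS.comp_extClass,
      Abelian.Ext.comp_zero]

end

end localCohomology
end DimensionShift

/-! ### Local cohomology under restriction of scalars along a finite map -/

section RestrictScalars

variable {B A : Type u} [CommRing B] [CommRing A] [Algebra B A]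

namespace localCohomology

section FiniteHom

variable (Q : ModuleCat.{u} B)

/-- For `0 → K → F → Z → 0` with `F = Bᵐ`, the sequence `0 → Hom(Z, Q) → Hom(F, Q) → Hom(K, Q) → 0`. -/
def homComplex {Z : Type u} [AddCommGroup Z] [Module B Z] {m : ℕ} (π : (Fin m → B) →ₗ[B] Z) :
    ShortComplex (ModuleCat.{u} B) :=
  .mk (X₁ := .of B (Z →ₗ[B] Q)) (X₂ := .of B ((Fin m → B) →ₗ[B] Q))
    (X₃ := .of B (LinearMap.ker π →ₗ[B] Q))
    (ModuleCat.ofHom (LinearMap.lcomp B Q π))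
    (ModuleCat.ofHom (LinearMap.lcomp B Q (LinearMap.ker π).subtype)) (by
      ext f x
      exact (congrArg f x.2).trans (map_zero f))

variable {Q} {Z : Type u} [AddCommGroup Z] [Module B Z] {m : ℕ} {π : (Fin m → B) →ₗ[B] Z}

lemma homComplex_shortExact [Injective Q] (hπ : Function.Surjective π) :
    (homComplex Q π).ShortExact where
  exact := by
    rw [ShortComplex.moduleCat_exact_iff]
    intro (g : (Fin m → B) →ₗ[B] Q) hg
    have hk : LinearMap.ker π ≤ LinearMap.ker g :=
      fun x hx => LinearMap.congr_fun hg ⟨x, hx⟩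
    refine ⟨(LinearMap.ker π).liftQ g hk ∘ₗ (π.quotKerEquivOfSurjective hπ).symm.toLinearMap, ?_⟩
    refine LinearMap.ext fun x => ?_
    change (LinearMap.ker π).liftQ g hk ((π.quotKerEquivOfSurjective hπ).symm (π x)) = g x
    rw [show (π.quotKerEquivOfSurjective hπ).symm (π x) = Submodule.Quotient.mk x from
      (LinearEquiv.symm_apply_eq _).2 rfl]
    rfl
  mono_f := by
    rw [ModuleCat.mono_iff_injective]
    intro f g h
    refine LinearMap.ext fun z => ?_
    obtain ⟨x, rfl⟩ := hπ z
    exact LinearMap.congr_fun h x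
  epi_g := by
    rw [ModuleCat.epi_iff_surjective]
    intro g
    have : Module.Injective B Q := Module.injective_module_of_injective_object B Q
    obtain ⟨h, hh⟩ := Module.Injective.extension_property B Q _ _ (LinearMap.ker π).subtype
      (Submodule.injective_subtype _) g
    exact ⟨h, hh⟩

instance injective_homComplex_X₂ [Injective Q] (π : (Fin m → B) →ₗ[B] Z) :
    Injective (homComplex Q π).X₂ := by
  have : Module.Injective B Q := Module.injective_module_of_injective_object B Q
  exact Injective.of_iso (((Pi.basisFun B (Fin m)).constr B).toModuleIso)
    (Module.injective_object_of_injective_module B (Fin m → Q))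

/-- Let `K = ker π` and `F = Bᵐ`. By Artin–Rees, `I^(n+k) F ∩ K ⊆ I^n K`, which `c` kills; so `c`
factors through the image of `K` in `F / I^(n+k) F` and extends from there by injectivity of `Q`. -/
lemma exists_isPowTorsion_extension [IsNoetherianRing B] [Injective Q] (I : Ideal B)
    (c : (homComplex Q π).X₃) (hc : IsPowTorsion I c) :
    ∃ e : (homComplex Q π).X₂, IsPowTorsion I e ∧ (homComplex Q π).g e = c := by
  obtain ⟨n, hn⟩ := hc
  have : Module.Injective B Q := Module.injective_module_of_injective_object B Q
  obtain ⟨k, hk⟩ := Ideal.exists_pow_inf_eq_pow_smul I (LinearMap.ker π)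
  let q : LinearMap.ker π →ₗ[B] (Fin m → B) ⧸ (I ^ (n + k) • (⊤ : Submodule B (Fin m → B))) :=
    (Submodule.mkQ _) ∘ₗ (LinearMap.ker π).subtype
  let c' : LinearMap.ker π →ₗ[B] Q := c
  have hq : LinearMap.ker q ≤ LinearMap.ker c' := by
    intro x hx
    have hx' : (x : Fin m → B) ∈ I ^ n • (LinearMap.ker π) := by
      have h1 : (x : Fin m → B) ∈ I ^ (n + k) • (⊤ : Submodule B (Fin m → B)) ⊓
          LinearMap.ker π := ⟨by simpa [q] using hx, x.2⟩
      rw [hk _ (Nat.le_add_left _ _), Nat.add_sub_cancel] at h1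
      exact Submodule.smul_mono le_rfl inf_le_right h1
    have hx'' : x ∈ I ^ n • (⊤ : Submodule B (LinearMap.ker π)) := by
      have : I ^ n • (LinearMap.ker π) =
          (I ^ n • (⊤ : Submodule B (LinearMap.ker π))).map (LinearMap.ker π).subtype := by
        rw [Submodule.map_smul'', Submodule.map_subtype_top]
      rw [this] at hx'
      obtain ⟨y, hy, hyx⟩ := hx'
      rwa [← Subtype.ext hyx]
    refine (Submodule.smul_le.2 fun a ha y _ => ?_ :
      I ^ n • (⊤ : Submodule B (LinearMap.ker π)) ≤ LinearMap.ker c') hx''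
    rw [LinearMap.mem_ker, map_smul]
    exact LinearMap.congr_fun (hn a ha) y
  obtain ⟨h, hh⟩ := Module.Injective.extension_property B Q _ _
    ((LinearMap.ker q).liftQ q le_rfl)
    (LinearMap.ker_eq_bot.1 (Submodule.ker_liftQ_eq_bot _ _ _ le_rfl))
    ((LinearMap.ker q).liftQ c' hq)
  refine ⟨h ∘ₗ Submodule.mkQ _, ⟨n + k, fun a ha => LinearMap.ext fun x => ?_⟩,
    LinearMap.ext fun x => LinearMap.congr_fun hh (Submodule.Quotient.mk x)⟩
  change a • h (Submodule.Quotient.mk x) = 0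
  rw [← map_smul, ← Submodule.Quotient.mk_smul, (Submodule.Quotient.mk_eq_zero _).2
    (Submodule.smul_mem_smul ha Submodule.mem_top), map_zero]

lemma eventuallyZero_finite_hom [IsNoetherianRing B] [Injective Q] (I : Ideal B) (i : ℕ)
    (Z : Type u) [AddCommGroup Z] [Module B Z] [Module.Finite B Z] :
    EventuallyZero I (i + 1) (ModuleCat.of B (Z →ₗ[B] Q)) := by
  induction i generalizing Z with
  | zero =>
    obtain ⟨m, π, hπ⟩ := Module.Finite.exists_fin' B Z
    exact EventuallyZero.shift_one (homComplex_shortExact (Q := Q) hπ)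
      (exists_isPowTorsion_extension I) (EventuallyZero.of_injective (homComplex Q π).X₂)
  | succ i ih =>
    obtain ⟨m, π, hπ⟩ := Module.Finite.exists_fin' B Z
    exact EventuallyZero.shift (homComplex_shortExact (Q := Q) hπ)
      (ih (LinearMap.ker π)) (EventuallyZero.of_injective (homComplex Q π).X₂)

end FiniteHom

instance finite_restrictScalars [Module.Finite B A] :
    Module.Finite B ((ModuleCat.restrictScalars (algebraMap B A)).obj (.of A A)) :=
  Module.Finite.equiv
    { toFun := fun a : A => (show (ModuleCat.restrictScalars (algebraMap B A)).obj (.of A A) from a)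
      invFun := fun a => a
      map_add' := fun _ _ => rfl
      map_smul' := fun b a => Algebra.smul_def b a
      left_inv := fun _ => rfl
      right_inv := fun _ => rfl : A ≃ₗ[B] _ }

/-- The underlying `B`-module of the coinduced module of `Q` is `Hom_B(A, Q)`. -/
def restrictCoextendIso (Q : ModuleCat.{u} B) :
    (ModuleCat.restrictScalars (algebraMap B A)).obj
      ((ModuleCat.coextendScalars (algebraMap B A)).obj Q) ≅
    ModuleCat.of B ((ModuleCat.restrictScalars (algebraMap B A)).obj (.of A A) →ₗ[B] Q) :=
  let e : ((ModuleCat.restrictScalars (algebraMap B A)).obj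
      ((ModuleCat.coextendScalars (algebraMap B A)).obj Q) : ModuleCat B) ≃ₗ[B]
        ((ModuleCat.restrictScalars (algebraMap B A)).obj (.of A A) →ₗ[B] Q) :=
    { toFun := fun g => ModuleCat.CoextendScalars.equiv (algebraMap B A) Q g
      invFun := fun g => (ModuleCat.CoextendScalars.equiv (algebraMap B A) Q).symm g
      map_add' := fun x y => map_add (ModuleCat.CoextendScalars.equiv (algebraMap B A) Q) x y
      map_smul' := fun b g => by
        refine LinearMap.ext fun a => ?_
        let g' := ModuleCat.CoextendScalars.equiv (algebraMap B A) Q g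
        change g' ((show A from a) * algebraMap B A b : A) = b • g' a
        rw [← map_smul, mul_comm]
        rfl
      left_inv := fun g => rfl
      right_inv := fun g => rfl }
  e.toModuleIso

/-- Embed `E` over `B` into an injective `Q`. The adjoint map `E → Hom_B(A, Q)` is mono and splits
because `E` is injective over `A`; finite `Hom` modules into `Q` are covered by
`eventuallyZero_finite_hom`. -/
lemma eventuallyZero_restrictScalars [IsNoetherianRing B] [Module.Finite B A] (I : Ideal B) (i : ℕ)
    (E : ModuleCat.{u} A) [Injective E] :
    EventuallyZero I (i + 1) ((ModuleCat.restrictScalars (algebraMap B A)).obj E) := by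
  let F := ModuleCat.restrictScalars.{u} (algebraMap B A)
  let adj := ModuleCat.restrictCoextendScalarsAdj.{u} (algebraMap B A)
  let h := adj.homEquiv E _ (Injective.ι (F.obj E))
  have hh : F.map h ≫ adj.counit.app _ = Injective.ι (F.obj E) := by
    have := (adj.homEquiv E (Injective.under (F.obj E))).symm_apply_apply (Injective.ι (F.obj E))
    rwa [adj.homEquiv_counit] at this
  have : Mono h := by
    -- The adjoint `h` followed by the counit is the original embedding, which forces `h` to be
    -- mono.
    have : Mono (F.map h ≫ adj.counit.app _) := hh ▸ inferInstance
    have : Mono (F.map h) := mono_of_mono (F.map h) (adj.counit.app _)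
    exact F.mono_of_mono_map this
  let r : Retract E ((ModuleCat.coextendScalars (algebraMap B A)).obj
    (Injective.under (F.obj E))) :=
    ⟨h, Injective.factorThru (𝟙 E) h, Injective.comp_factorThru _ _⟩
  exact (EventuallyZero.of_retract (Retract.ofIso (restrictCoextendIso _))
    (eventuallyZero_finite_hom I i _)).of_retract (r.map F)

/-- An embedding of a module into an injective one, with its cokernel. -/
def injectiveSequence (M : ModuleCat.{u} A) : ShortComplex (ModuleCat.{u} A) :=
  .mk (Injective.ι M) (Limits.cokernel.π (Injective.ι M)) (by simp)

lemma injectiveSequence_shortExact (M : ModuleCat.{u} A) : (injectiveSequence M).ShortExact where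
  exact := ShortComplex.exact_cokernel _
  mono_f := inferInstanceAs (Mono (Injective.ι M))
  epi_g := inferInstanceAs (Epi (Limits.cokernel.π (Injective.ι M)))

instance (M : ModuleCat.{u} A) : Injective (injectiveSequence M).X₂ :=
  inferInstanceAs (Injective (Injective.under M))

/-- The morphism of injective sequences induced by a morphism of modules. -/
def injectiveSequenceMap {M N : ModuleCat.{u} A} (f : M ⟶ N) :
    injectiveSequence M ⟶ injectiveSequence N where
  τ₁ := f
  τ₂ := (Injective.factorThru (f ≫ Injective.ι N) (Injective.ι M) :
    Injective.under M ⟶ Injective.under N)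
  τ₃ := Limits.cokernel.map _ _ f (Injective.factorThru (f ≫ Injective.ι N) (Injective.ι M))
    (by simp)
  comm₁₂ := by simp [injectiveSequence]
  comm₂₃ := by simp [injectiveSequence]

lemma isPowTorsion_restrictScalars_iff {I : Ideal B} {J : Ideal A}
    (hIJ : I.map (algebraMap B A) ≤ J) {k : ℕ} (hJI : J ^ k ≤ I.map (algebraMap B A))
    (M : ModuleCat.{u} A) (x : M) :
    IsPowTorsion I (show (ModuleCat.restrictScalars (algebraMap B A)).obj M from x) ↔
      IsPowTorsion J x := by
  constructor
  · rintro ⟨n, hn⟩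
    refine ⟨k * n, fun a ha => ?_⟩
    have h1 : J ^ (k * n) ≤ (I ^ n).map (algebraMap B A) := by
      rw [pow_mul, Ideal.map_pow]
      exact Ideal.pow_right_mono hJI n
    refine (Ideal.map_le_iff_le_comap.2 fun b hb => ?_ :
      (I ^ n).map (algebraMap B A) ≤ LinearMap.ker (LinearMap.toSpanSingleton A M x)) (h1 ha)
    exact hn b hb
  · rintro ⟨n, hn⟩
    refine ⟨n, fun b hb => hn (algebraMap B A b) ?_⟩
    exact Ideal.pow_right_mono hIJ n (Ideal.map_pow (algebraMap B A) I n ▸ Ideal.mem_map_of_mem _ hb)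

/-- Embed `M` and `N` into injective `A`-modules. The middle terms have no higher local cohomology
over either ring, so degree `i + 2` reduces to degree `i + 1` of the cokernels. Degrees `0` and `1`
depend only on torsion elements, which are the same for `I` and `J`. -/
theorem EventuallyInjective.restrictScalars [IsNoetherianRing B] [Module.Finite B A]
    {I : Ideal B} {J : Ideal A}
    (hIJ : I.map (algebraMap B A) ≤ J) {k : ℕ} (hJI : J ^ k ≤ I.map (algebraMap B A))
    (i : ℕ) {M N : ModuleCat.{u} A} (f : M ⟶ N) (h : EventuallyInjective J i f) :
    EventuallyInjective I i ((ModuleCat.restrictScalars (algebraMap B A)).map f) := by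
  have tors := isPowTorsion_restrictScalars_iff hIJ hJI
  let F := ModuleCat.restrictScalars.{u} (algebraMap B A)
  have exact (M : ModuleCat.{u} A) : ((injectiveSequence M).map F).ShortExact :=
    (injectiveSequence_shortExact M).map_of_exact F
  have zero (M : ModuleCat.{u} A) (i : ℕ) :
      EventuallyZero I (i + 1) ((injectiveSequence M).map F).X₂ :=
    eventuallyZero_restrictScalars I i (injectiveSequence M).X₂
  match i with
  | 0 =>
    rw [eventuallyInjective_zero_iff] at h ⊢
    exact fun x hx h0 => h x ((tors M x).1 hx) h0
  | 1 =>
    have h1 := (eventuallyInjective_one_iff (injectiveSequence_shortExact M)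
      (injectiveSequence_shortExact N) (injectiveSequenceMap f)
      (EventuallyZero.of_injective _)).1 h
    refine (eventuallyInjective_one_iff (exact M) (exact N)
      (F.mapShortComplex.map (injectiveSequenceMap f)) (zero M 0)).2 ?_
    rintro c hc ⟨e, he, hec⟩
    obtain ⟨e', he', hec'⟩ := h1 c ((tors _ _).1 hc) ⟨e, (tors _ _).1 he, hec⟩
    exact ⟨e', (tors _ _).2 he', hec'⟩
  | i + 2 =>
    have h1 := EventuallyInjective.shift_τ₃ (injectiveSequence_shortExact M)
      (injectiveSequence_shortExact N) (injectiveSequenceMap f) h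
      (EventuallyZero.of_injective _)
    exact EventuallyInjective.shift_τ₁ (exact M) (exact N)
      (F.mapShortComplex.map (injectiveSequenceMap f))
      (EventuallyInjective.restrictScalars hIJ hJI (i + 1) _ h1) (zero M (i + 1)) (zero N i)

theorem injective_map_restrictScalars [IsNoetherianRing B] [Module.Finite B A]
    {I : Ideal B} {J : Ideal A}
    (hIJ : I.map (algebraMap B A) ≤ J) {k : ℕ} (hJI : J ^ k ≤ I.map (algebraMap B A))
    (i : ℕ) {M N : ModuleCat.{u} A} (f : M ⟶ N)
    (h : Function.Injective ((localCohomology J i).map f)) :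
    Function.Injective ((localCohomology I i).map
      ((ModuleCat.restrictScalars (algebraMap B A)).map f)) :=
  (injective_map_iff _).2
    (EventuallyInjective.restrictScalars hIJ hJI i f ((injective_map_iff f).1 h))

end localCohomology
end RestrictScalars

/-! ### Descent of `F`-injectivity and `F`-rationality -/

namespace IsSplitRadicial

section LocalCohomology

variable {B A : Type u} [CommRing B] [CommRing A] [Algebra B A] {p : ℕ} [Fact p.Prime]
  [CharP B p] [CharP A p]

variable (B A) in
/-- The inclusion of `B` into `A` as a map of `B`-modules. -/
def inclusion : ModuleCat.of B B ⟶ (ModuleCat.restrictScalars (algebraMap B A)).obj (.of A A) :=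
  ModuleCat.ofHom (Y := (ModuleCat.restrictScalars (algebraMap B A)).obj (.of A A))
    { toFun := fun b => algebraMap B A b
      map_add' := map_add (algebraMap B A)
      map_smul' := fun b x => map_mul (algebraMap B A) b x }

variable (B A p) in
/-- The inclusion of `F^e_* B` into `F^e_* A` as a map of `B`-modules. -/
def inclusionPushforward (e : ℕ) : ModuleCat.of B (FrobeniusPushforward B p e) ⟶
    (ModuleCat.restrictScalars (algebraMap B A)).obj (.of A (FrobeniusPushforward A p e)) :=
  ModuleCat.ofHom
    (Y := (ModuleCat.restrictScalars (algebraMap B A)).obj (.of A (FrobeniusPushforward A p e)))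
    { toFun := fun b => FrobeniusPushforward.mk p e (algebraMap B A (show B from b))
      map_add' := map_add (algebraMap B A)
      map_smul' := fun b x => by
        change algebraMap B A (iterateFrobenius B p e b * (show B from x)) =
          iterateFrobenius A p e (algebraMap B A b) * algebraMap B A (show B from x)
        rw [map_mul, iterateFrobenius_def, iterateFrobenius_def, map_pow] }

omit [Fact p.Prime] [CharP B p] [CharP A p] in
lemma injective_map_inclusion (h : IsSplitRadicial B A p) (I : Ideal B) (i : ℕ) :
    Function.Injective ((localCohomology I i).map (inclusion B A)) := by
  obtain ⟨π, hπ⟩ := h.exists_retraction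
  let ρ : (ModuleCat.restrictScalars (algebraMap B A)).obj (.of A A) ⟶ ModuleCat.of B B :=
    ModuleCat.ofHom (X := (ModuleCat.restrictScalars (algebraMap B A)).obj (.of A A))
      { toFun := fun a => π a
        map_add' := map_add π
        map_smul' := fun b a => by
          change π (algebraMap B A b * (show A from a)) = b * π (show A from a)
          rw [← Algebra.smul_def, map_smul, smul_eq_mul] }
  have hρ : inclusion B A ≫ ρ = 𝟙 _ := by
    refine ModuleCat.hom_ext (LinearMap.ext_ring ?_)
    change π (algebraMap B A 1) = 1
    rw [map_one, hπ]
  have : IsSplitMono (inclusion B A) := ⟨⟨⟨ρ, hρ⟩⟩⟩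
  exact (ModuleCat.mono_iff_injective _).1 inferInstance

lemma inclusion_comp_frobenius (e : ℕ) :
    ModuleCat.ofHom (frobeniusLinear B p e) ≫ inclusionPushforward B A p e =
      inclusion B A ≫ (ModuleCat.restrictScalars (algebraMap B A)).map
        (ModuleCat.ofHom (frobeniusLinear A p e)) := by
  refine ModuleCat.hom_ext (LinearMap.ext fun b => ?_)
  change algebraMap B A (iterateFrobenius B p e b) = iterateFrobenius A p e (algebraMap B A b)
  rw [iterateFrobenius_def, iterateFrobenius_def, map_pow]

lemma inclusionPushforward_comp_mul (e : ℕ) (c : B) :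
    ModuleCat.ofHom (frobeniusMul p e c) ≫ inclusionPushforward B A p e =
      inclusionPushforward B A p e ≫ (ModuleCat.restrictScalars (algebraMap B A)).map
        (ModuleCat.ofHom (frobeniusMul p e (algebraMap B A c))) :=
  ModuleCat.hom_ext (LinearMap.ext fun b => map_mul (algebraMap B A) c b)

section LocalRing

variable [IsNoetherianRing B] [IsNoetherianRing A] [Module.Finite B A] [IsLocalRing B]
  [IsLocalRing A]

omit [CharP B p] [CharP A p] in
/-- If `f' : A → N` induces an injection on local cohomology and restricts to `f : B → M`, then
`f` induces an injection on local cohomology. -/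
lemma injective_map_of_comm (h : IsSplitRadicial B A p) (i : ℕ) {M : ModuleCat.{u} B}
    {N : ModuleCat.{u} A} {f : ModuleCat.of B B ⟶ M} {f' : ModuleCat.of A A ⟶ N}
    {j : M ⟶ (ModuleCat.restrictScalars (algebraMap B A)).obj N}
    (hj : f ≫ j = inclusion B A ≫ (ModuleCat.restrictScalars (algebraMap B A)).map f')
    (hf' : Function.Injective ((localCohomology (IsLocalRing.maximalIdeal A) i).map f')) :
    Function.Injective ((localCohomology (IsLocalRing.maximalIdeal B) i).map f) := by
  obtain ⟨k, hk⟩ := h.exists_maximalIdeal_pow_le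
  have h1 := localCohomology.injective_map_restrictScalars h.map_maximalIdeal_le hk i f' hf'
  have h2 := h.injective_map_inclusion (IsLocalRing.maximalIdeal B) i
  rw [← ModuleCat.mono_iff_injective] at h1 h2 ⊢
  have h3 := mono_comp ((localCohomology (IsLocalRing.maximalIdeal B) i).map (inclusion B A))
    ((localCohomology (IsLocalRing.maximalIdeal B) i).map
      ((ModuleCat.restrictScalars (algebraMap B A)).map f'))
  rw [← Functor.map_comp, ← hj, Functor.map_comp] at h3
  -- The first factor of a mono is mono, so nothing need be known about `j` on local cohomology.
  exact mono_of_mono _ ((localCohomology (IsLocalRing.maximalIdeal B) i).map j)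

theorem isFInjectiveLocal (h : IsSplitRadicial B A p) (hA : IsFInjectiveLocal A p) :
    IsFInjectiveLocal B p :=
  fun i => h.injective_map_of_comm i (inclusion_comp_frobenius 1) (hA i)

theorem isFRationalLocal (h : IsSplitRadicial B A p) (hA : IsFRationalLocal A p) :
    IsFRationalLocal B p := by
  refine ⟨h.isCohenMacaulayLocal hA.1, fun d hd c hc => ?_⟩
  obtain ⟨e, he, hinj⟩ := hA.2 d (h.ringKrullDim_eq.trans hd) _
    (h.algebraMap_notMem_of_mem_minimalPrimes hc)
  refine ⟨e, he, ?_⟩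
  -- Frobenius and multiplication by `c` are merged into one linear map, to which
  -- `injective_map_of_comm` applies.
  rw [← Functor.map_comp] at hinj ⊢
  refine h.injective_map_of_comm d (j := inclusionPushforward B A p e) ?_ hinj
  rw [Category.assoc, inclusionPushforward_comp_mul, ← Category.assoc, inclusion_comp_frobenius,
    Category.assoc, ← Functor.map_comp]

end LocalRing

end LocalCohomology

section Global

variable {B A : Type u} [CommRing B] [CommRing A] [Algebra B A] {p : ℕ} [Fact p.Prime]
  [CharP B p] [CharP A p] [IsNoetherianRing A]

theorem isFInjective (h : IsSplitRadicial B A p) (hfin : (algebraMap B A).Finite)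
    (hA : IsFInjective A p) : IsFInjective B p := by
  intro q _
  have := h.isNoetherianRing
  obtain ⟨P, hP, _, h', hfin'⟩ := h.exists_localization_atPrime q
  have := hfin' hfin
  exact h'.isFInjectiveLocal (hA P)

theorem isFRational (h : IsSplitRadicial B A p) (hfin : (algebraMap B A).Finite)
    (hA : IsFRational A p) : IsFRational B p := by
  intro q _
  have := h.isNoetherianRing
  obtain ⟨P, hP, _, h', hfin'⟩ := h.exists_localization_atPrime q
  have := hfin' hfin
  exact h'.isFRationalLocal (hA P)

end Global

end IsSplitRadicial

end

theorem mainTheorem2 {k : Type*} [Field k] [PerfectField k] (p : ℕ) [Fact p.Prime] [CharP k p]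
    {A : Type u} [CommRing A] [Algebra k A] [CharP A p] [IsNoetherianRing A]
    (hA : IsFFinite A p) (D : Derivation k A A) (hD : D.IsMultiplicative p) :
    (IsNoetherianRing D.constants ∧ IsFFinite D.constants p) ∧
    (∀ r : ℕ, SatisfiesSerre A r → SatisfiesSerre D.constants r) ∧
    (IsFPure A p → IsFPure D.constants p) ∧
    (IsFRational A p → IsFRational D.constants p) ∧
    (IsFInjective A p → IsFInjective D.constants p) ∧
    (IsStronglyFRegular A p → IsStronglyFRegular D.constants p) ∧
    (IsTightlyFRegular A p → IsTightlyFRegular D.constants p) := by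
  have h := hD.isSplitRadicial
  have hfin := h.algebraMap_finite hA
  have := h.isNoetherianRing
  exact ⟨⟨this, h.isFFinite hA⟩, fun _ => h.satisfiesSerre, h.isFPure, h.isFRational hfin,
    h.isFInjective hfin, h.isStronglyFRegular, h.isTightlyFRegular⟩
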